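/- Let $\mathbb{T}\subseteq\mathbb{R}$ be a time scale (a nonempty closed set), let $a<b$ be points of $\mathbb{T}$, and regard $[a,b]=\{t\in\mathbb{T}: a\le t\le b\}$ as a time scale with forward and backward jump operators $\sigma(t)=\inf\{s\in[a,b]:s>t\}$ and $\rho(t)=\sup\{s\in[a,b]:s<t\}$ (with $\sigma(b)=b$, $\rho(a)=a$). For a time scale $S$ with maximum $m$ put $S^\kappa=S\setminus(\rho_S(m),m]$, where $\rho_S$ is the backward jump operator of $S$, and $S^{\kappa^2}=(S^\kappa)^\kappa$. For $y:[a,b]\to\mathbb{R}$ let $y^\Delta$ (on $[a,b]^\kappa$) be its delta derivative, $y^{\Delta\Delta}=(y^\Delta)^\Delta$ (on $[a,b]^{\kappa^2}$, the outer derivative being taken on the time scale $[a,b]^\kappa$), and $y^\sigma=y\circ\sigma$. A function is rd-continuous if it is continuous at the right-dense points ($\sigma(t)=t$) and has finite left-sided limits at the left-dense points ($\rho(t)=t$) of its domain; $C^2_{\mathrm{rd}}$ is the set of twice delta differentiable $y:[a,b]\to\mathbb{R}$ with $y^{\Delta\Delta}$ rd-continuous. The delta integral is $\int_a^b f(t)\,\Delta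 t=F(b)-F(a)$, where $F^\Delta=f$ on $[a,b]^\kappa$. Let $q:[a,b]\to\mathbb{R}$ be continuous. A real number $\lambda$ is an eigenvalue, with eigenfunction $y$, if $y\in C^2_{\mathrm{rd}}$ is not identically $0$ on $[a,b]$, $y(a)=y(b)=0$, and $$y^{\Delta\Delta}(t)+q(t)y^\sigma(t)+\lambda y^\sigma(t)=0\quad\text{for all } t\in[a,b]^{\kappa^2}\text{ with }\sigma(t)\in[a,b]^\kappa .$$ (The condition $\sigma(t)\in[a,b]^\kappa$ holds for all $t\in[a,b]^{\kappa^2}$, unless $[a,b]=\{a,b\}$ or $\rho(b)<b$ is left-dense, in which case it omits only $t=\rho(b)$.) The first eigenvalue $\lambda_1$ is the least eigenvalue. Put $$J(y)=\int_a^b\big((y^\Delta)^2(t)-q(t)(y^\sigma)^2(t)\big)\Delta t,\qquad I(y)=\int_a^b (y^\sigma)^2(t)\,\Delta t .$$ If $[a,b]$ has at least three points, then the first eigenvalue $\lambda_1$ exists and has an eigenfunction $y_1$ with $I(y_1)=1$. Moreover, whenever $\lambda_1$ is the first eigenvalue and $y_1$ is an eigenfunction for $\lambda_1$ with $I(y_1)=1$,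 the functional $J$ restricted to the set of all $y\in C^2_{\mathrm{rd}}$ with $y(a)=y(b)=0$ and $I(y)=1$ attains its minimum at $y_1$, and $J(y_1)=\lambda_1$. -/

import Mathlib

namespace TimeScale

noncomputable section

open Set Filter Topology

/-- The forward jump operator of the time scale `T`, with the convention `inf ∅ = sup T`. -/
def sigma (T : Set ℝ) (t : ℝ) : ℝ :=
  open Classical in
  if {s | s ∈ T ∧ t < s}.Nonempty then sInf {s | s ∈ T ∧ t < s} else sSup T

/-- The backward jump operator of the time scale `T`, with the convention `sup ∅ = inf T`. -/
def rho (T : Set ℝ) (t : ℝ) : ℝ :=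
  open Classical in
  if {s | s ∈ T ∧ s < t}.Nonempty then sSup {s | s ∈ T ∧ s < t} else sInf T

/-- The set `T^κ = T \ (ρ(sup T), sup T]` (and `T^κ = T` if `T` is unbounded above). -/
def kappa (T : Set ℝ) : Set ℝ :=
  open Classical in
  if BddAbove T then T \ Ioc (rho T (sSup T)) (sSup T) else T

/-- The time scale interval `[a, b] = {t ∈ 𝕋 : a ≤ t ≤ b}`, itself a time scale. -/
def interval (𝕋 : Set ℝ) (a b : ℝ) : Set ℝ := {t | t ∈ 𝕋 ∧ a ≤ t ∧ t ≤ b}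

/-- `d` is a delta derivative of `f` at `t`, for the time scale `T`.
Only the values of `f` on `T` matter. -/
def HasDeltaDerivAt (T : Set ℝ) (f : ℝ → ℝ) (d t : ℝ) : Prop :=
  ∀ ε > 0, ∃ δ > 0, ∀ s ∈ T, |s - t| < δ →
    |f (sigma T t) - f s - d * (sigma T t - s)| ≤ ε * |sigma T t - s|

/-- `f` is delta differentiable at `t`, for the time scale `T`. -/
def DeltaDifferentiableAt (T : Set ℝ) (f : ℝ → ℝ) (t : ℝ) : Prop :=
  ∃ d, HasDeltaDerivAt T f d t

/-- The delta derivative `f^Δ(t)` (and `0` where `f` is not delta differentiable). -/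
def deltaDeriv (T : Set ℝ) (f : ℝ → ℝ) (t : ℝ) : ℝ :=
  open Classical in
  if h : DeltaDifferentiableAt T f t then h.choose else 0

/-- The second delta derivative `f^{ΔΔ} = (f^Δ)^Δ`; since `f^Δ` is a function on `T^κ`, the outer
delta derivative is taken for the time scale `T^κ`. -/
def deltaDeriv2 (T : Set ℝ) (f : ℝ → ℝ) : ℝ → ℝ := deltaDeriv (kappa T) (deltaDeriv T f)

/-- Rd-continuity of a function `f` with domain `D ⊆ T`: it is continuous at the right-dense
points and has a finite left-sided limit at the left-dense points, where right-dense and left-dense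
refer to the time scale `T`. -/
def RdContinuousOn (T D : Set ℝ) (f : ℝ → ℝ) : Prop :=
  ∀ t ∈ D, (sigma T t = t → ContinuousWithinAt f D t) ∧
    (rho T t = t → ∃ l, Tendsto f (𝓝[D ∩ Iio t] t) (𝓝 l))

/-- The class `C²_rd`: twice delta differentiable functions (on `T^κ` and `T^{κ²}` respectively)
with rd-continuous second delta derivative. -/
structure IsC2rd (T : Set ℝ) (y : ℝ → ℝ) : Prop where
  diff : ∀ t ∈ kappa T, DeltaDifferentiableAt T y t
  diff2 : ∀ t ∈ kappa (kappa T), DeltaDifferentiableAt (kappa T) (deltaDeriv T y) t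
  rd : RdContinuousOn T (kappa (kappa T)) (deltaDeriv2 T y)

/-- `F` is an antiderivative of `f` on the time scale `T`. -/
def IsAntiderivative (T : Set ℝ) (f F : ℝ → ℝ) : Prop :=
  ∀ t ∈ kappa T, HasDeltaDerivAt T F (f t) t

/-- The delta integral `∫_a^b f(t) Δt = F(b) - F(a)`, where `F` is an antiderivative of `f` (every
rd-continuous function has one; the value is `0` by convention if there is none). -/
def deltaIntegral (T : Set ℝ) (a b : ℝ) (f : ℝ → ℝ) : ℝ :=
  open Classical in
  if h : ∃ F, IsAntiderivative T f F then h.choose b - h.choose a else 0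

/-- `y` solves `y^{ΔΔ} + q y^σ + lam y^σ = 0` on the time scale `T` (here a time scale interval).
The equation is imposed at the points `t` of `T^{κ²}` for which `y^Δ(σ(t))` is defined, i.e.
`σ(t) ∈ T^κ`. This is all of `T^{κ²}`, except that `t = ρ(max T)` is left out if it is smaller than
`max T` and left-dense; at that point `C²_rd` still forces `y^Δ` to be continuous. (It also leaves
out the only point of `T^{κ²}` if `T` has just two points.) -/
def IsSolution (T : Set ℝ) (q : ℝ → ℝ) (lam : ℝ) (y : ℝ → ℝ) : Prop :=
  IsC2rd T y ∧ ∀ t ∈ kappa (kappa T), sigma T t ∈ kappa T →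
    deltaDeriv2 T y t + q t * y (sigma T t) + lam * y (sigma T t) = 0

/-- `y` is an eigenfunction for `lam`: a nontrivial solution on `[a, b]` with `y(a) = y(b) = 0`. -/
def IsEigenfunction (𝕋 : Set ℝ) (a b : ℝ) (q : ℝ → ℝ) (lam : ℝ) (y : ℝ → ℝ) : Prop :=
  IsSolution (interval 𝕋 a b) q lam y ∧ y a = 0 ∧ y b = 0 ∧ ∃ t ∈ interval 𝕋 a b, y t ≠ 0

/-- The set of eigenvalues of the Sturm–Liouville problem. -/
def eigenvalues (𝕋 : Set ℝ) (a b : ℝ) (q : ℝ → ℝ) : Set ℝ :=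
  {lam | ∃ y, IsEigenfunction 𝕋 a b q lam y}

/-- `J(y) = ∫_a^b ((y^Δ)² - q (y^σ)²) Δt`. -/
def J (𝕋 : Set ℝ) (a b : ℝ) (q y : ℝ → ℝ) : ℝ :=
  deltaIntegral (interval 𝕋 a b) a b fun t =>
    deltaDeriv (interval 𝕋 a b) y t ^ 2 - q t * y (sigma (interval 𝕋 a b) t) ^ 2

/-- `I(y) = ∫_a^b (y^σ)² Δt`. -/
def I (𝕋 : Set ℝ) (a b : ℝ) (y : ℝ → ℝ) : ℝ :=
  deltaIntegral (interval 𝕋 a b) a b fun t => y (sigma (interval 𝕋 a b) t) ^ 2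

/-- The `C²_rd` functions on `[a, b]` with `y(a) = y(b) = 0` and `I(y) = 1`. -/
def admissible (𝕋 : Set ℝ) (a b : ℝ) : Set (ℝ → ℝ) :=
  {y | IsC2rd (interval 𝕋 a b) y ∧ y a = 0 ∧ y b = 0 ∧ I 𝕋 a b y = 1}

end

end TimeScale

/-!
For each `lam` let `y` be the solution of the equation with `y a = 0`, `y^Δ a = 1`. If it is
positive on `(a, b]`, Picone's identity
`(η^Δ)² - (q + lam) (η^σ)² = (η² y^Δ / y)^Δ + (η^Δ y - η y^Δ)² / (y y^σ)`
shows `lam I(η) ≤ J(η)` for every `η` vanishing at `a` and `b`. Let `lam₁` be the supremum of these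
`lam`; it is finite by testing against one `η`, and the bound persists in the limit. The solution
`y₁` for `lam₁` is nonnegative but, positivity being an open condition on `lam`, has a zero in
`(a, b]`. Comparing Wronskians with a positive solution for a smaller `lam` shows that `y₁^Δ < 0` at
its first zero, so that zero is `b` and `y₁` is an eigenfunction. Since `J(y) = lam I(y)` for
every eigenfunction `y`, the bound makes `lam₁` the least eigenvalue and the minimum of `J`.
-/

namespace TimeScale

open Set Filter Topology MeasureTheory

section Jump

variable {T : Set ℝ} {s t x : ℝ}

theorem sigma_eq_sInf (hs : s ∈ T) (hts : t < s) : sigma T t = sInf {s | s ∈ T ∧ t < s} :=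
  if_pos ⟨s, hs, hts⟩

theorem sigma_le (hs : s ∈ T) (hts : t < s) : sigma T t ≤ s :=
  (sigma_eq_sInf hs hts).trans_le (csInf_le ⟨t, fun _ hx => hx.2.le⟩ ⟨hs, hts⟩)

theorem sigma_eq_self_of_isGreatest (ht : IsGreatest T t) : sigma T t = t := by
  rw [sigma, if_neg, ht.csSup_eq]
  rintro ⟨s, hs, hts⟩
  exact hts.not_ge (ht.2 hs)

theorem isGreatest_or_exists_gt (ht : t ∈ T) : IsGreatest T t ∨ ∃ s ∈ T, t < s := by
  by_contra! h
  exact h.1 ⟨ht, h.2⟩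

theorem le_sigma (ht : t ∈ T) : t ≤ sigma T t := by
  rcases isGreatest_or_exists_gt ht with h | ⟨s, hs, hts⟩
  · exact (sigma_eq_self_of_isGreatest h).ge
  · rw [sigma_eq_sInf hs hts]
    exact le_csInf ⟨s, hs, hts⟩ fun _ hx => hx.2.le

theorem sigma_mem (hT : IsClosed T) (ht : t ∈ T) : sigma T t ∈ T := by
  rcases isGreatest_or_exists_gt ht with h | ⟨s, hs, hts⟩
  · rwa [sigma_eq_self_of_isGreatest h]
  · rw [sigma_eq_sInf hs hts]
    exact closure_minimal (fun _ hx => hx.1) hT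
      (csInf_mem_closure (s := {s | s ∈ T ∧ t < s}) ⟨s, hs, hts⟩ ⟨t, fun _ hx => hx.2.le⟩)

theorem sigma_monotoneOn : MonotoneOn (sigma T) T := by
  intro s _ t ht hst
  rcases hst.eq_or_lt with rfl | h
  · exact le_rfl
  · exact (sigma_le ht h).trans (le_sigma ht)

theorem exists_mem_Ioo_of_sigma_eq (h : sigma T t = t) (hs : s ∈ T) (hts : t < s) (hx : t < x) :
    ∃ y ∈ T, y ∈ Ioo t x := by
  rw [sigma_eq_sInf hs hts] at h
  obtain ⟨y, hy, hyx⟩ :=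
    exists_lt_of_csInf_lt (s := {s | s ∈ T ∧ t < s}) ⟨s, hs, hts⟩ (h.trans_lt hx)
  exact ⟨y, hy.1, hy.2, hyx⟩

theorem neBot_nhdsWithin_Ioi_of_sigma_eq (h : sigma T t = t) (hs : s ∈ T) (hts : t < s) :
    (𝓝[T ∩ Ioi t] t).NeBot := by
  refine mem_closure_iff_nhdsWithin_neBot.1 (Metric.mem_closure_iff.2 fun ε hε => ?_)
  obtain ⟨x, hx, htx, hxε⟩ := exists_mem_Ioo_of_sigma_eq h hs hts (lt_add_of_pos_right t hε)
  refine ⟨x, ⟨hx, htx⟩, ?_⟩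
  rwa [dist_comm, Real.dist_eq, abs_of_pos (sub_pos.2 htx), sub_lt_iff_lt_add']

theorem rho_eq_sSup (hs : s ∈ T) (hst : s < t) : rho T t = sSup {s | s ∈ T ∧ s < t} :=
  if_pos ⟨s, hs, hst⟩

theorem le_rho (hs : s ∈ T) (hst : s < t) : s ≤ rho T t :=
  (rho_eq_sSup hs hst).symm ▸
    le_csSup (s := {s | s ∈ T ∧ s < t}) ⟨t, fun _ hx => hx.2.le⟩ ⟨hs, hst⟩

theorem rho_eq_self_of_isLeast (ht : IsLeast T t) : rho T t = t := by
  rw [rho, if_neg, ht.csInf_eq]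
  rintro ⟨s, hs, hst⟩
  exact hst.not_ge (ht.2 hs)

theorem isLeast_or_exists_lt (ht : t ∈ T) : IsLeast T t ∨ ∃ s ∈ T, s < t := by
  by_contra! h
  exact h.1 ⟨ht, h.2⟩

theorem rho_le (ht : t ∈ T) : rho T t ≤ t := by
  rcases isLeast_or_exists_lt ht with h | ⟨s, hs, hst⟩
  · exact (rho_eq_self_of_isLeast h).le
  · rw [rho_eq_sSup hs hst]
    exact csSup_le ⟨s, hs, hst⟩ fun _ hx => hx.2.le

theorem rho_mem (hT : IsClosed T) (ht : t ∈ T) : rho T t ∈ T := by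
  rcases isLeast_or_exists_lt ht with h | ⟨s, hs, hst⟩
  · rwa [rho_eq_self_of_isLeast h]
  · rw [rho_eq_sSup hs hst]
    exact closure_minimal (fun _ hx => hx.1) hT
      (csSup_mem_closure (s := {s | s ∈ T ∧ s < t}) ⟨s, hs, hst⟩ ⟨t, fun _ hx => hx.2.le⟩)

theorem exists_mem_Ioo_of_rho_eq (h : rho T t = t) (hs : s ∈ T) (hst : s < t) (hx : x < t) :
    ∃ y ∈ T, y ∈ Ioo x t := by
  rw [rho_eq_sSup hs hst] at h
  obtain ⟨y, hy, hxy⟩ :=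
    exists_lt_of_lt_csSup (s := {s | s ∈ T ∧ s < t}) ⟨s, hs, hst⟩ (hx.trans_eq h.symm)
  exact ⟨y, hy.1, hxy, hy.2⟩

theorem tendsto_sigma_of_sigma_eq (ht : t ∈ T) (h : sigma T t = t) :
    Tendsto (sigma T) (𝓝[T] t) (𝓝 t) := by
  refine tendsto_order.2 ⟨fun l hl => ?_, fun u hu => ?_⟩
  · filter_upwards [self_mem_nhdsWithin, mem_nhdsWithin_of_mem_nhds (Ioi_mem_nhds hl)] with s hs hls
    exact lt_of_lt_of_le hls (le_sigma hs)
  · by_cases hy : ∃ y ∈ T, y ∈ Ioo t u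
    · obtain ⟨y, hyT, hty, hyu⟩ := hy
      filter_upwards [mem_nhdsWithin_of_mem_nhds (Iio_mem_nhds hty)] with s hsy
      exact (sigma_le hyT hsy).trans_lt hyu
    · filter_upwards [self_mem_nhdsWithin, mem_nhdsWithin_of_mem_nhds (Iio_mem_nhds hu)]
        with s hs hsu
      have hst : s ≤ t := not_lt.1 fun hts => hy ⟨s, hs, hts, hsu⟩
      exact ((sigma_monotoneOn hs ht hst).trans_eq h).trans_lt hu

theorem tendsto_sigma_left (ht : t ∈ T) : Tendsto (sigma T) (𝓝[T ∩ Iio t] t) (𝓝 t) := by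
  refine tendsto_of_tendsto_of_tendsto_of_le_of_le' (tendsto_id.mono_left nhdsWithin_le_nhds)
    tendsto_const_nhds ?_ ?_
  · filter_upwards [self_mem_nhdsWithin] with s hs using le_sigma hs.1
  · filter_upwards [self_mem_nhdsWithin] with s hs using sigma_le ht hs.2

end Jump

section DeltaDerivative

variable {T : Set ℝ} {f g : ℝ → ℝ} {d e t : ℝ}

theorem hasDeltaDerivAt_iff_isLittleO :
    HasDeltaDerivAt T f d t ↔ (fun s => f (sigma T t) - f s - d * (sigma T t - s))
      =o[𝓝[T] t] fun s => sigma T t - s := by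
  simp only [HasDeltaDerivAt, Asymptotics.isLittleO_iff, eventually_nhdsWithin_iff,
    Metric.eventually_nhds_iff, Real.dist_eq, Real.norm_eq_abs]
  exact forall₂_congr fun ε _ => ⟨fun ⟨δ, hδ, H⟩ => ⟨δ, hδ, fun s hst hs => H s hs hst⟩,
    fun ⟨δ, hδ, H⟩ => ⟨δ, hδ, fun s hs hst => H hst hs⟩⟩

theorem HasDeltaDerivAt.sub_eq (h : HasDeltaDerivAt T f d t) (ht : t ∈ T) :
    f (sigma T t) - f t = d * (sigma T t - t) := by
  have hpure := (hasDeltaDerivAt_iff_isLittleO.1 h).mono (pure_le_nhdsWithin ht)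
  by_cases hσ : sigma T t = t
  · simp [hσ]
  · have := Asymptotics.isLittleO_pure.1 hpure
    linarith

theorem HasDeltaDerivAt.continuousWithinAt (h : HasDeltaDerivAt T f d t) (ht : t ∈ T) :
    ContinuousWithinAt f T t := by
  have hσ : Tendsto (fun s => sigma T t - s) (𝓝[T] t) (𝓝 (sigma T t - t)) :=
    (tendsto_const_nhds.sub tendsto_id).mono_left nhdsWithin_le_nhds
  have herr : Tendsto (fun s => f (sigma T t) - f s - d * (sigma T t - s)) (𝓝[T] t) (𝓝 0) :=
    (Asymptotics.isLittleO_one_iff ℝ).1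
      ((hasDeltaDerivAt_iff_isLittleO.1 h).trans_isBigO (hσ.isBigO_one ℝ))
  have hlim := (tendsto_const_nhds (x := f (sigma T t))).sub ((hσ.const_mul d).add herr)
  have hval : f (sigma T t) - (d * (sigma T t - t) + 0) = f t := by linarith [h.sub_eq ht]
  rw [hval] at hlim
  exact hlim.congr fun s => by ring

theorem hasDeltaDerivAt_iff_of_eq (hσ : sigma T t = t) :
    HasDeltaDerivAt T f d t ↔ HasDerivWithinAt f d T t := by
  rw [hasDeltaDerivAt_iff_isLittleO, hasDerivWithinAt_iff_isLittleO, hσ,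
    ← Asymptotics.isLittleO_neg_left, ← Asymptotics.isLittleO_neg_right]
  refine Asymptotics.isLittleO_congr (Eventually.of_forall fun s => ?_)
    (Eventually.of_forall fun s => ?_) <;> simp only [smul_eq_mul] <;> ring

theorem hasDeltaDerivAt_iff (ht : t ∈ T) :
    HasDeltaDerivAt T f d t ↔ ContinuousWithinAt f T t ∧
      f (sigma T t) - f t = d * (sigma T t - t) ∧
      (sigma T t = t → HasDerivWithinAt f d T t) := by
  refine ⟨fun h => ⟨h.continuousWithinAt ht, h.sub_eq ht, fun hσ =>
    (hasDeltaDerivAt_iff_of_eq hσ).1 h⟩, fun ⟨hcont, hjump, hderiv⟩ => ?_⟩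
  by_cases hσ : sigma T t = t
  · exact (hasDeltaDerivAt_iff_of_eq hσ).2 (hderiv hσ)
  have hσs : Tendsto (fun s => sigma T t - s) (𝓝[T] t) (𝓝 (sigma T t - t)) :=
    (tendsto_const_nhds.sub tendsto_id).mono_left nhdsWithin_le_nhds
  have herr : Tendsto (fun s => f (sigma T t) - f s - d * (sigma T t - s)) (𝓝[T] t) (𝓝 0) := by
    have := (tendsto_const_nhds (x := f (sigma T t))).sub hcont |>.sub (hσs.const_mul d)
    rwa [hjump, sub_self] at this
  rw [hasDeltaDerivAt_iff_isLittleO]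
  exact ((Asymptotics.isLittleO_one_iff ℝ).2 herr).trans_isBigO
    ((Asymptotics.isBigO_const_left_iff_pos_le_norm one_ne_zero).2
      ⟨|sigma T t - t| / 2, by have := sub_ne_zero.2 hσ; positivity,
        hσs.norm.eventually_const_le (half_lt_self (by simpa using sub_ne_zero.2 hσ))⟩)

theorem hasDeltaDerivAt_const (c : ℝ) : HasDeltaDerivAt T (fun _ => c) 0 t := by
  simp [hasDeltaDerivAt_iff_isLittleO]

theorem hasDeltaDerivAt_id : HasDeltaDerivAt T (fun s => s) 1 t := by
  simp [hasDeltaDerivAt_iff_isLittleO]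

theorem HasDeltaDerivAt.congr (hT : IsClosed T) (ht : t ∈ T) (h : HasDeltaDerivAt T f d t)
    (hfg : EqOn g f T) : HasDeltaDerivAt T g d t := by
  rw [hasDeltaDerivAt_iff_isLittleO] at h ⊢
  refine h.congr' ?_ EventuallyEq.rfl
  filter_upwards [self_mem_nhdsWithin] with s hs
  rw [hfg (sigma_mem hT ht), hfg hs]

theorem HasDeltaDerivAt.sub (hf : HasDeltaDerivAt T f d t) (hg : HasDeltaDerivAt T g e t) :
    HasDeltaDerivAt T (fun s => f s - g s) (d - e) t := by
  rw [hasDeltaDerivAt_iff_isLittleO] at *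
  exact (hf.sub hg).congr_left fun s => by ring

theorem HasDeltaDerivAt.const_mul (c : ℝ) (hf : HasDeltaDerivAt T f d t) :
    HasDeltaDerivAt T (fun s => c * f s) (c * d) t := by
  rw [hasDeltaDerivAt_iff_isLittleO] at *
  exact (hf.const_mul_left c).congr_left fun s => by ring

theorem HasDeltaDerivAt.mul (ht : t ∈ T) (hf : HasDeltaDerivAt T f d t)
    (hg : HasDeltaDerivAt T g e t) :
    HasDeltaDerivAt T (fun s => f s * g s) (d * g t + f (sigma T t) * e) t := by
  rw [hasDeltaDerivAt_iff ht] at *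
  obtain ⟨hfc, hfj, hfd⟩ := hf
  obtain ⟨hgc, hgj, hgd⟩ := hg
  refine ⟨hfc.mul hgc, by linear_combination g t * hfj + f (sigma T t) * hgj, fun hσ => ?_⟩
  rw [hσ]
  exact (hfd hσ).mul (hgd hσ)

theorem HasDeltaDerivAt.div (ht : t ∈ T) (hf : HasDeltaDerivAt T f d t)
    (hg : HasDeltaDerivAt T g e t) (hgt : g t ≠ 0) (hgσ : g (sigma T t) ≠ 0) :
    HasDeltaDerivAt T (fun s => f s / g s) ((d * g t - f t * e) / (g t * g (sigma T t))) t := by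
  rw [hasDeltaDerivAt_iff ht] at *
  obtain ⟨hfc, hfj, hfd⟩ := hf
  obtain ⟨hgc, hgj, hgd⟩ := hg
  refine ⟨hfc.div hgc hgt, ?_, fun hσ => ?_⟩
  · field_simp
    linear_combination g t * hfj - f t * hgj
  · rw [hσ, ← sq]
    exact (hfd hσ).div (hgd hσ) hgt

theorem HasDeltaDerivAt.unique (ht : t ∈ T) (hacc : sigma T t = t → AccPt t (𝓟 T))
    (h : HasDeltaDerivAt T f d t) (h' : HasDeltaDerivAt T f e t) : d = e := by
  by_cases hσ : sigma T t = t
  · exact (uniqueDiffWithinAt_iff_accPt.2 (hacc hσ)).eq_deriv _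
      ((hasDeltaDerivAt_iff_of_eq hσ).1 h) ((hasDeltaDerivAt_iff_of_eq hσ).1 h')
  · exact mul_right_cancel₀ (sub_ne_zero.2 hσ) ((h.sub_eq ht).symm.trans (h'.sub_eq ht))

theorem DeltaDifferentiableAt.hasDeltaDerivAt (h : DeltaDifferentiableAt T f t) :
    HasDeltaDerivAt T f (deltaDeriv T f t) t := by
  rw [deltaDeriv, dif_pos h]
  exact h.choose_spec

end DeltaDerivative

section MeanValue

variable {T : Set ℝ} {f f' : ℝ → ℝ} {c d t u w : ℝ}

theorem mul_sub_le_sub_of_forall_exists (hT : IsClosed T) (hu : u ∈ T) (huw : u ≤ w)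
    (hf : ContinuousOn f (T ∩ Icc u w))
    (hstep : ∀ x ∈ T ∩ Ico u w, ∃ y ∈ T ∩ Ioc x w, c * (y - x) ≤ f y - f x) :
    c * (w - u) ≤ f w - f u := by
  set A : Set ℝ := {x ∈ T ∩ Icc u w | c * (x - u) ≤ f x - f u}
  have hA : IsCompact A := by
    have hclosed : IsClosed A :=
      (hT.inter isClosed_Icc).isClosed_le (by fun_prop) (hf.sub continuousOn_const)
    exact (isCompact_Icc.inter_left hT).of_isClosed_subset hclosed (sep_subset _ _)
  obtain ⟨m, ⟨⟨hmT, hum, hmw⟩, hm⟩, hmax⟩ :=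
    hA.exists_isGreatest ⟨u, ⟨hu, le_rfl, huw⟩, by simp⟩
  obtain rfl | hlt := hmw.eq_or_lt
  · exact hm
  obtain ⟨y, ⟨hyT, hmy, hyw⟩, hy⟩ := hstep m ⟨hmT, hum, hlt⟩
  have hyA : y ∈ A := ⟨⟨hyT, hum.trans hmy.le, hyw⟩, by linarith⟩
  exact absurd (hmax hyA) hmy.not_ge

theorem HasDeltaDerivAt.exists_mul_sub_le_sub (hT : IsClosed T) (ht : t ∈ T) (hw : w ∈ T)
    (htw : t < w) (h : HasDeltaDerivAt T f d t) (hcd : c < d) :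
    ∃ y ∈ T ∩ Ioc t w, c * (y - t) ≤ f y - f t := by
  rcases (le_sigma ht).eq_or_lt with hσ | hσ
  · obtain ⟨δ, hδ, H⟩ := h (d - c) (sub_pos.2 hcd)
    obtain ⟨y, hy, hty, hyw⟩ := exists_mem_Ioo_of_sigma_eq hσ.symm hw htw
      (lt_min htw (lt_add_of_pos_right t hδ))
    obtain ⟨hyw, hyδ⟩ := lt_min_iff.1 hyw
    refine ⟨y, ⟨hy, hty, hyw.le⟩, ?_⟩
    have hbound := H y hy (by rw [abs_of_pos] <;> linarith)
    rw [← hσ, abs_sub_comm t y, abs_of_pos (sub_pos.2 hty)] at hbound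
    linarith [(abs_le.1 hbound).2]
  · refine ⟨sigma T t, ⟨sigma_mem hT ht, hσ, sigma_le hw htw⟩, ?_⟩
    rw [h.sub_eq ht]
    exact mul_le_mul_of_nonneg_right hcd.le (sub_nonneg.2 hσ.le)

theorem mul_sub_le_sub_of_le_deltaDeriv (hT : IsClosed T) (hu : u ∈ T) (hw : w ∈ T) (huw : u ≤ w)
    (hf : ContinuousOn f (T ∩ Icc u w))
    (hderiv : ∀ t ∈ T ∩ Ico u w, HasDeltaDerivAt T f (f' t) t)
    (hle : ∀ t ∈ T ∩ Ico u w, c ≤ f' t) : c * (w - u) ≤ f w - f u := by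
  have hlt : ∀ c' < c, c' * (w - u) ≤ f w - f u := fun c' hc' =>
    mul_sub_le_sub_of_forall_exists hT hu huw hf fun x hx =>
      (hderiv x hx).exists_mul_sub_le_sub hT hx.1 hw hx.2.2 (hc'.trans_le (hle x hx))
  refine le_of_tendsto (f := fun c' => c' * (w - u)) (x := 𝓝[<] c)
    (((continuous_mul_const _).tendsto c).mono_left nhdsWithin_le_nhds) ?_
  filter_upwards [self_mem_nhdsWithin] with c' hc' using hlt c' hc'

end MeanValue

/-- `T` is a compact time scale with least element `a` and greatest element `b`. -/
structure IsCompactScale (T : Set ℝ) (a b : ℝ) : Prop where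
  isCompact : IsCompact T
  isLeast : IsLeast T a
  isGreatest : IsGreatest T b

theorem isCompactScale_interval {𝕋 : Set ℝ} {a b : ℝ} (h𝕋 : IsClosed 𝕋) (ha : a ∈ 𝕋) (hb : b ∈ 𝕋)
    (hab : a ≤ b) : IsCompactScale (interval 𝕋 a b) a b where
  isCompact := isCompact_Icc.inter_left h𝕋
  isLeast := ⟨⟨ha, le_rfl, hab⟩, fun _ ht => ht.2.1⟩
  isGreatest := ⟨⟨hb, hab, le_rfl⟩, fun _ ht => ht.2.2⟩

theorem sigma_inter_Iic {T : Set ℝ} {c t : ℝ} (hT : IsClosed T) (ht : t ∈ T)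
    (hc : sigma T t ≤ c) : sigma (T ∩ Iic c) t = sigma T t := by
  have htc : t ∈ T ∩ Iic c := ⟨ht, (le_sigma ht).trans hc⟩
  have hσ : sigma T t ∈ T ∩ Iic c := ⟨sigma_mem hT ht, hc⟩
  have hσ' := sigma_mem (hT.inter isClosed_Iic) htc
  refine le_antisymm ?_ ?_
  · rcases (le_sigma ht).eq_or_lt with h | h
    · by_contra! hlt
      rw [← h] at hlt
      obtain ⟨y, hy, hty, hy'⟩ := exists_mem_Ioo_of_sigma_eq h.symm hσ'.1 hlt hlt
      exact (sigma_le (show y ∈ T ∩ Iic c from ⟨hy, hy'.le.trans hσ'.2⟩) hty).not_gt hy'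
    · exact sigma_le hσ h
  · rcases (le_sigma htc).eq_or_lt with h | h
    · by_contra! hlt
      rw [← h] at hlt
      obtain ⟨y, hy, hty, hy'⟩ := exists_mem_Ioo_of_sigma_eq h.symm hσ hlt hlt
      exact (sigma_le hy.1 hty).not_gt hy'
    · exact sigma_le hσ'.1 h

namespace IsCompactScale

variable {T : Set ℝ} {f f' : ℝ → ℝ} {a b c d t : ℝ}

theorem left_mem (hT : IsCompactScale T a b) : a ∈ T := hT.isLeast.1

theorem right_mem (hT : IsCompactScale T a b) : b ∈ T := hT.isGreatest.1

theorem left_le (hT : IsCompactScale T a b) (ht : t ∈ T) : a ≤ t := hT.isLeast.2 ht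

theorem le_right (hT : IsCompactScale T a b) (ht : t ∈ T) : t ≤ b := hT.isGreatest.2 ht

theorem left_le_right (hT : IsCompactScale T a b) : a ≤ b := hT.left_le hT.right_mem

theorem isClosed (hT : IsCompactScale T a b) : IsClosed T := hT.isCompact.isClosed

theorem inter_Iic (hT : IsCompactScale T a b) (hc : c ∈ T) : IsCompactScale (T ∩ Iic c) a c where
  isCompact := hT.isCompact.inter_right isClosed_Iic
  isLeast := ⟨⟨hT.left_mem, hT.left_le hc⟩, fun _ ht => hT.left_le ht.1⟩
  isGreatest := ⟨⟨hc, le_refl c⟩, fun _ ht => ht.2⟩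

theorem rho_right_mem (hT : IsCompactScale T a b) : rho T b ∈ T := rho_mem hT.isClosed hT.right_mem

theorem kappa_eq (hT : IsCompactScale T a b) : kappa T = T ∩ Iic (rho T b) := by
  rw [kappa, if_pos hT.isCompact.bddAbove, hT.isGreatest.csSup_eq]
  ext t
  simp only [Set.mem_sdiff, mem_Ioc, not_and_or, not_lt, mem_inter_iff, mem_Iic]
  exact and_congr_right fun ht => or_iff_left (not_not.2 (hT.le_right ht))

theorem kappa_subset (hT : IsCompactScale T a b) : kappa T ⊆ T :=
  hT.kappa_eq.trans_subset inter_subset_left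

theorem le_rho_right (hT : IsCompactScale T a b) (ht : t ∈ kappa T) : t ≤ rho T b :=
  (hT.kappa_eq ▸ ht).2

theorem mem_kappa_of_lt (hT : IsCompactScale T a b) (ht : t ∈ T) (h : t < b) : t ∈ kappa T :=
  hT.kappa_eq ▸ ⟨ht, le_rho ht h⟩

protected theorem kappa (hT : IsCompactScale T a b) : IsCompactScale (kappa T) a (rho T b) :=
  hT.kappa_eq ▸ hT.inter_Iic hT.rho_right_mem

theorem kappa_eq_self_or_lt (hT : IsCompactScale T a b) :
    kappa T = T ∨ ∀ t ∈ kappa T, t < b := by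
  rcases (rho_le hT.right_mem).eq_or_lt with h | h
  · exact .inl (by rw [hT.kappa_eq, h]; exact inter_eq_left.2 fun t ht => hT.le_right ht)
  · exact .inr fun t ht => (hT.le_rho_right ht).trans_lt h

theorem eq_right_of_notMem_kappa (hT : IsCompactScale T a b) (ht : t ∈ T)
    (h : t ∉ kappa T) : t = b :=
  (hT.le_right ht).eq_of_not_lt fun hlt => h (hT.mem_kappa_of_lt ht hlt)

theorem sigma_kappa (hT : IsCompactScale T a b) (ht : t ∈ T) (h : sigma T t ∈ kappa T) :
    sigma (kappa T) t = sigma T t := by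
  rw [hT.kappa_eq]
  exact sigma_inter_Iic hT.isClosed ht (hT.le_rho_right h)

theorem rho_kappa (hT : IsCompactScale T a b) (ht : t ∈ kappa T) :
    rho (kappa T) t = rho T t := by
  have hset : {s | s ∈ kappa T ∧ s < t} = {s | s ∈ T ∧ s < t} := by
    ext s
    exact and_congr_left fun hst => ⟨fun hs => hT.kappa_subset hs,
      fun hs => hT.mem_kappa_of_lt hs (hst.trans_le (hT.le_right (hT.kappa_subset ht)))⟩
  rw [rho, rho, hset, hT.kappa.isLeast.csInf_eq, hT.isLeast.csInf_eq]

theorem nhdsWithin_kappa (hT : IsCompactScale T a b) (ht : t ∈ kappa T) :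
    𝓝[kappa T] t = 𝓝[T] t := by
  rcases hT.kappa_eq_self_or_lt with h | h
  · rw [h]
  · refine le_antisymm (nhdsWithin_mono _ hT.kappa_subset) (nhdsWithin_le_iff.2 ?_)
    filter_upwards [self_mem_nhdsWithin, mem_nhdsWithin_of_mem_nhds (Iio_mem_nhds (h t ht))]
      with s hs hsb using hT.mem_kappa_of_lt hs hsb

theorem hasDeltaDerivAt_kappa_iff (hT : IsCompactScale T a b) (ht : t ∈ kappa T)
    (h : sigma T t ∈ kappa T) :
    HasDeltaDerivAt (kappa T) f d t ↔ HasDeltaDerivAt T f d t := by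
  simp only [hasDeltaDerivAt_iff_isLittleO, hT.sigma_kappa (hT.kappa_subset ht) h,
    hT.nhdsWithin_kappa ht]

theorem mem_kappa_kappa (hT : IsCompactScale T a b) (ht : t ∈ kappa T)
    (h : sigma T t ∈ kappa T) : t ∈ kappa (kappa T) := by
  rcases hT.kappa_eq_self_or_lt with hκ | hκ
  · rwa [hκ]
  · refine hT.kappa.mem_kappa_of_lt ht ((hT.le_rho_right ht).lt_of_ne fun hρ => ?_)
    have hσ : sigma T t = t :=
      le_antisymm ((hT.le_rho_right h).trans_eq hρ.symm) (le_sigma (hT.kappa_subset ht))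
    obtain ⟨x, hx, htx, hxb⟩ := exists_mem_Ioo_of_sigma_eq hσ hT.right_mem (hκ t ht) (hκ t ht)
    exact (le_rho hx hxb).not_gt (hρ ▸ htx)

theorem accPt_of_sigma_eq (hT : IsCompactScale T a b) (hab : a < b) (ht : t ∈ kappa T)
    (hσ : sigma T t = t) : AccPt t (𝓟 T) := by
  refine accPt_iff_nhds.2 fun U hU => ?_
  obtain ⟨l, u, htlu, hlu⟩ := mem_nhds_iff_exists_Ioo_subset.1 hU
  rcases (hT.le_right (hT.kappa_subset ht)).eq_or_lt with rfl | htb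
  · obtain ⟨y, hy, hly, hyt⟩ := exists_mem_Ioo_of_rho_eq
      (le_antisymm (rho_le hT.right_mem) (hT.le_rho_right ht)) hT.left_mem hab htlu.1
    exact ⟨y, ⟨hlu ⟨hly, hyt.trans htlu.2⟩, hy⟩, hyt.ne⟩
  · obtain ⟨y, hy, hty, hyu⟩ := exists_mem_Ioo_of_sigma_eq hσ hT.right_mem htb htlu.2
    exact ⟨y, ⟨hlu ⟨htlu.1.trans hty, hyu⟩, hy⟩, hty.ne'⟩

theorem deltaDeriv_eq (hT : IsCompactScale T a b) (hab : a < b) (ht : t ∈ kappa T)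
    (h : HasDeltaDerivAt T f d t) : deltaDeriv T f t = d :=
  (DeltaDifferentiableAt.hasDeltaDerivAt ⟨d, h⟩).unique (hT.kappa_subset ht)
    (hT.accPt_of_sigma_eq hab ht) h

theorem continuousOn_of_kappa (hT : IsCompactScale T a b)
    (hf : ∀ t ∈ kappa T, ContinuousWithinAt f T t) : ContinuousOn f T := by
  intro t ht
  by_cases htκ : t ∈ kappa T
  · exact hf t htκ
  obtain rfl := hT.eq_right_of_notMem_kappa ht htκ
  have hρ : rho T t < t := not_le.1 fun h => htκ (hT.kappa_eq ▸ ⟨ht, h⟩)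
  have hisolated : 𝓝[T] t ≤ pure t := by
    rw [le_pure_iff]
    filter_upwards [self_mem_nhdsWithin, mem_nhdsWithin_of_mem_nhds (Ioi_mem_nhds hρ)] with s hs hρs
    exact (hT.le_right hs).eq_of_not_lt fun hst => (le_rho hs hst).not_gt hρs
  exact (tendsto_pure_nhds f t).mono_left hisolated

theorem continuousOn_of_hasDeltaDerivAt (hT : IsCompactScale T a b)
    (h : ∀ t ∈ kappa T, HasDeltaDerivAt T f (f' t) t) : ContinuousOn f T :=
  hT.continuousOn_of_kappa fun t ht => (h t ht).continuousWithinAt (hT.kappa_subset ht)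

theorem mul_sub_le_sub (hT : IsCompactScale T a b)
    (hderiv : ∀ t ∈ kappa T, HasDeltaDerivAt T f (f' t) t)
    (hle : ∀ t ∈ kappa T, c ≤ f' t) {u w : ℝ} (hu : u ∈ T) (hw : w ∈ T) (huw : u ≤ w) :
    c * (w - u) ≤ f w - f u := by
  have hκ : T ∩ Ico u w ⊆ kappa T := fun t ht =>
    hT.mem_kappa_of_lt ht.1 (ht.2.2.trans_le (hT.le_right hw))
  exact mul_sub_le_sub_of_le_deltaDeriv hT.isClosed hu hw huw
    ((hT.continuousOn_of_hasDeltaDerivAt hderiv).mono inter_subset_left)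
    (fun t ht => hderiv t (hκ ht)) fun t ht => hle t (hκ ht)

theorem sub_eq_sub_of_isAntiderivative {F G : ℝ → ℝ} (hT : IsCompactScale T a b)
    (hF : IsAntiderivative T f F) (hG : IsAntiderivative T f G) {u w : ℝ} (hu : u ∈ T) (hw : w ∈ T)
    (huw : u ≤ w) : F w - F u = G w - G u := by
  have hFG := hT.mul_sub_le_sub (c := 0) (f' := fun t => f t - f t)
    (fun t ht => (hF t ht).sub (hG t ht)) (fun t _ => (sub_self _).ge) hu hw huw
  have hGF := hT.mul_sub_le_sub (c := 0) (f' := fun t => f t - f t)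
    (fun t ht => (hG t ht).sub (hF t ht)) (fun t _ => (sub_self _).ge) hu hw huw
  linarith

theorem deltaIntegral_eq {F : ℝ → ℝ} (hT : IsCompactScale T a b) (hF : IsAntiderivative T f F) :
    deltaIntegral T a b f = F b - F a := by
  have h : ∃ F, IsAntiderivative T f F := ⟨F, hF⟩
  rw [deltaIntegral, dif_pos h]
  exact hT.sub_eq_sub_of_isAntiderivative h.choose_spec hF hT.left_mem hT.right_mem
    hT.left_le_right

end IsCompactScale

section RdContinuous

variable {T D : Set ℝ} {f g : ℝ → ℝ} {t : ℝ}

theorem rdContinuousOn_of_continuousOn (hf : ContinuousOn f D) : RdContinuousOn T D f :=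
  fun t ht => ⟨fun _ => hf t ht, fun _ => ⟨f t, (hf t ht).mono_left
    (nhdsWithin_mono _ inter_subset_left)⟩⟩

theorem RdContinuousOn.continuous_comp₂ {φ : ℝ × ℝ → ℝ} (hφ : Continuous φ)
    (hf : RdContinuousOn T D f) (hg : RdContinuousOn T D g) :
    RdContinuousOn T D fun t => φ (f t, g t) := by
  refine fun t ht => ⟨fun hσ => hφ.continuousAt.comp_continuousWithinAt
    (((hf t ht).1 hσ).prodMk ((hg t ht).1 hσ)), fun hρ => ?_⟩
  obtain ⟨k, hk⟩ := (hf t ht).2 hρ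
  obtain ⟨l, hl⟩ := (hg t ht).2 hρ
  exact ⟨φ (k, l), (hφ.tendsto (k, l)).comp (hk.prodMk_nhds hl)⟩

theorem RdContinuousOn.sub (hf : RdContinuousOn T D f) (hg : RdContinuousOn T D g) :
    RdContinuousOn T D fun t => f t - g t :=
  hf.continuous_comp₂ continuous_sub hg

theorem RdContinuousOn.mul (hf : RdContinuousOn T D f) (hg : RdContinuousOn T D g) :
    RdContinuousOn T D fun t => f t * g t :=
  hf.continuous_comp₂ continuous_mul hg

theorem RdContinuousOn.pow (hf : RdContinuousOn T D f) (n : ℕ) :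
    RdContinuousOn T D fun t => f t ^ n :=
  hf.continuous_comp₂ (φ := fun p => p.1 ^ n) (by fun_prop) hf

theorem rdContinuousOn_comp_sigma (hT : IsClosed T) (hf : ContinuousOn f T) :
    RdContinuousOn T T fun t => f (sigma T t) := by
  have hlim : ∀ t ∈ T, ∀ S ⊆ T, Tendsto (sigma T) (𝓝[S] t) (𝓝 t) →
      Tendsto (fun s => f (sigma T s)) (𝓝[S] t) (𝓝 (f t)) := fun t ht S hS hσ =>
    (hf t ht).tendsto.comp (tendsto_nhdsWithin_iff.2
      ⟨hσ, eventually_nhdsWithin_of_forall fun s hs => sigma_mem hT (hS hs)⟩)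
  refine fun t ht => ⟨fun hσ => ?_, fun _ => ⟨f t, ?_⟩⟩
  · rw [ContinuousWithinAt, hσ]
    exact hlim t ht T Subset.rfl (tendsto_sigma_of_sigma_eq ht hσ)
  · exact hlim t ht _ inter_subset_left (tendsto_sigma_left ht)

theorem RdContinuousOn.exists_eventually_abs_le (hf : RdContinuousOn T T f) (ht : t ∈ T) :
    ∃ M, ∀ᶠ s in 𝓝[T] t, |f s| ≤ M := by
  have hleft : ∃ M, ∀ᶠ s in 𝓝[T] t, s < t → |f s| ≤ M := by
    rcases (rho_le ht).eq_or_lt with hρ | hρ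
    · obtain ⟨l, hl⟩ := (hf t ht).2 hρ
      refine ⟨|l| + 1, ?_⟩
      have hbound := eventually_nhdsWithin_iff.1 (hl.abs.eventually_le_const (lt_add_one |l|))
      filter_upwards [self_mem_nhdsWithin, mem_nhdsWithin_of_mem_nhds hbound]
        with s hs hsl hst using hsl ⟨hs, hst⟩
    · refine ⟨0, ?_⟩
      filter_upwards [self_mem_nhdsWithin, mem_nhdsWithin_of_mem_nhds (Ioi_mem_nhds hρ)]
        with s hs hρs hst
      exact absurd (le_rho hs hst) (not_le.2 hρs)
  have hright : ∃ M, ∀ᶠ s in 𝓝[T] t, t < s → |f s| ≤ M := by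
    rcases (le_sigma ht).eq_or_lt with hσ | hσ
    · refine ⟨|f t| + 1, ?_⟩
      filter_upwards [((hf t ht).1 hσ.symm).abs.eventually_le_const (lt_add_one |f t|)]
        with s hs _ using hs
    · refine ⟨0, ?_⟩
      filter_upwards [self_mem_nhdsWithin, mem_nhdsWithin_of_mem_nhds (Iio_mem_nhds hσ)]
        with s hs hsσ hts
      exact absurd (sigma_le hs hts) (not_le.2 hsσ)
  obtain ⟨M, hM⟩ := hleft
  obtain ⟨N, hN⟩ := hright
  refine ⟨max (max M N) |f t|, ?_⟩
  filter_upwards [hM, hN] with s hsM hsN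
  rcases lt_trichotomy s t with h | rfl | h
  · exact (hsM h).trans ((le_max_left _ _).trans (le_max_left _ _))
  · exact le_max_right _ _
  · exact (hsN h).trans ((le_max_right _ _).trans (le_max_left _ _))

theorem RdContinuousOn.exists_abs_le (hf : RdContinuousOn T T f) (hT : IsCompact T) :
    ∃ M, ∀ t ∈ T, |f t| ≤ M := by
  refine hT.induction_on ⟨0, by simp⟩ (fun S S' hS ⟨M, hM⟩ => ⟨M, fun t ht => hM t (hS ht)⟩) ?_ ?_
  · rintro S S' ⟨M, hM⟩ ⟨N, hN⟩
    exact ⟨max M N, fun t ht => ht.elim (fun h => (hM t h).trans (le_max_left _ _))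
      fun h => (hN t h).trans (le_max_right _ _)⟩
  · intro t ht
    obtain ⟨M, hM⟩ := hf.exists_eventually_abs_le ht
    exact ⟨_, hM, M, fun s hs => hs⟩

theorem countable_setOf_lt_sigma : {t ∈ T | t < sigma T t}.Countable :=
  (countable_image_lt_image_Ioi_within T id).mono fun t (ht : t ∈ T ∧ t < sigma T t) =>
    show t ∈ T ∧ ∃ z, t < z ∧ ∀ s ∈ T, t < s → z ≤ s from
      ⟨ht.1, sigma T t, ht.2, fun _ hs hts => sigma_le hs hts⟩

theorem RdContinuousOn.measurable_domRestrict (hf : RdContinuousOn T T f) :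
    Measurable (T.domRestrict f) := by
  have hcount : {t : T | (t : ℝ) < sigma T t}.Countable :=
    ((countable_setOf_lt_sigma (T := T)).preimage Subtype.val_injective).mono fun t ht =>
      show (t : ℝ) ∈ T ∧ (t : ℝ) < sigma T t from ⟨t.2, ht⟩
  refine measurable_of_restrict_of_restrict_compl hcount.measurableSet ?_ ?_
  · have := hcount.to_subtype
    exact measurable_of_countable _
  · refine (continuousOn_iff_continuous_domRestrict.1 fun t ht => ?_).measurable
    rw [mem_compl_iff, mem_ofPred_eq, not_lt] at ht
    exact ((continuousWithinAt_iff_continuousAt_domRestrict f t.2).1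
      ((hf t t.2).1 (ht.antisymm (le_sigma t.2)))).continuousWithinAt

end RdContinuous

section Primitive

/-- The greatest point of `T` that does not exceed `s` (and `a` for `s < a`), where `a = min T`. -/
noncomputable def floor (T : Set ℝ) (a s : ℝ) : ℝ := sSup (T ∩ Iic (max a s))

/-- The integral from `a` to `t` of the step extension `f ∘ floor T a` of `f`; for rd-continuous
`f` it is the delta antiderivative of `f` that vanishes at `a`. -/
noncomputable def primitive (T : Set ℝ) (a : ℝ) (f : ℝ → ℝ) (t : ℝ) : ℝ :=
  ∫ s in a..t, f (floor T a s)

variable {T : Set ℝ} {f g : ℝ → ℝ} {a b c l s t u w ε : ℝ}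

theorem primitive_left : primitive T a f a = 0 :=
  intervalIntegral.integral_same

theorem primitive_const_mul (c : ℝ) (f : ℝ → ℝ) (t : ℝ) :
    primitive T a (fun s => c * f s) t = c * primitive T a f t :=
  intervalIntegral.integral_const_mul _ _

namespace IsCompactScale

theorem isGreatest_floor (hT : IsCompactScale T a b) (s : ℝ) :
    IsGreatest (T ∩ Iic (max a s)) (floor T a s) :=
  (hT.isCompact.inter_right isClosed_Iic).isGreatest_sSup
    ⟨a, hT.left_mem, mem_Iic.2 (le_max_left _ _)⟩

theorem floor_mem (hT : IsCompactScale T a b) (s : ℝ) : floor T a s ∈ T :=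
  (hT.isGreatest_floor s).1.1

theorem floor_le (hT : IsCompactScale T a b) (hs : a ≤ s) : floor T a s ≤ s := by
  simpa only [max_eq_right hs, mem_Iic] using (hT.isGreatest_floor s).1.2

theorem le_floor (hT : IsCompactScale T a b) (ht : t ∈ T) (h : t ≤ s) : t ≤ floor T a s :=
  (hT.isGreatest_floor s).2 ⟨ht, h.trans (le_max_right _ _)⟩

theorem floor_mono (hT : IsCompactScale T a b) : Monotone (floor T a) := fun s t hst =>
  (hT.isGreatest_floor t).2
    ⟨hT.floor_mem s, (hT.isGreatest_floor s).1.2.trans (max_le_max le_rfl hst)⟩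

theorem floor_mem_Ico (hT : IsCompactScale T a b) (hu : u ∈ T) (hs : s ∈ Ico u w) :
    floor T a s ∈ T ∩ Ico u w :=
  ⟨hT.floor_mem s, hT.le_floor hu hs.1, (hT.floor_le ((hT.left_le hu).trans hs.1)).trans_lt hs.2⟩

theorem le_sigma_floor (hT : IsCompactScale T a b) (hs : s ≤ b) :
    s ≤ sigma T (floor T a s) := by
  by_contra! h
  have hσ : sigma T (floor T a s) = floor T a s :=
    le_antisymm (hT.le_floor (sigma_mem hT.isClosed (hT.floor_mem s)) h.le)
      (le_sigma (hT.floor_mem s))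
  obtain ⟨x, hx, hlt, hxs⟩ :=
    exists_mem_Ioo_of_sigma_eq hσ hT.right_mem ((hσ ▸ h).trans_le hs) (hσ ▸ h)
  exact (hT.le_floor hx hxs.le).not_gt hlt

theorem measurable_comp_floor (hT : IsCompactScale T a b) (hf : RdContinuousOn T T f) :
    Measurable fun s => f (floor T a s) :=
  hf.measurable_domRestrict.comp (hT.floor_mono.measurable.subtype_mk (h := hT.floor_mem))

theorem intervalIntegrable_comp_floor (hT : IsCompactScale T a b) (hf : RdContinuousOn T T f)
    (u w : ℝ) : IntervalIntegrable (fun s => f (floor T a s)) volume u w := by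
  obtain ⟨M, hM⟩ := hf.exists_abs_le hT.isCompact
  exact intervalIntegrable_iff.2 (Measure.integrableOn_of_bounded (M := M) (by simp)
    (hT.measurable_comp_floor hf).aestronglyMeasurable
    (Eventually.of_forall fun s => hM _ (hT.floor_mem s)))

theorem continuous_primitive (hT : IsCompactScale T a b) (hf : RdContinuousOn T T f) :
    Continuous (primitive T a f) :=
  intervalIntegral.continuous_primitive (hT.intervalIntegrable_comp_floor hf) a

theorem primitive_congr (hT : IsCompactScale T a b) (hfg : EqOn f g T) (t : ℝ) :
    primitive T a f t = primitive T a g t :=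
  intervalIntegral.integral_congr fun s _ => hfg (hT.floor_mem s)

theorem primitive_add (hT : IsCompactScale T a b) (hf : RdContinuousOn T T f)
    (hg : RdContinuousOn T T g) (t : ℝ) :
    primitive T a (fun s => f s + g s) t = primitive T a f t + primitive T a g t :=
  intervalIntegral.integral_add (hT.intervalIntegrable_comp_floor hf _ _)
    (hT.intervalIntegrable_comp_floor hg _ _)

theorem abs_primitive_sub_le (hT : IsCompactScale T a b) (hf : RdContinuousOn T T f) (hu : u ∈ T)
    (huw : u ≤ w) (h : ∀ x ∈ T ∩ Ico u w, |f x - l| ≤ ε) :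
    |primitive T a f w - primitive T a f u - l * (w - u)| ≤ ε * (w - u) := by
  have hint := hT.intervalIntegrable_comp_floor hf
  have heq : primitive T a f w - primitive T a f u - l * (w - u)
      = ∫ s in u..w, (f (floor T a s) - l) := by
    rw [intervalIntegral.integral_sub (hint _ _) (by simp), primitive, primitive,
      intervalIntegral.integral_interval_sub_left (hint _ _) (hint _ _)]
    simp [mul_comm]
  rw [heq, ← abs_of_nonneg (sub_nonneg.2 huw), ← Real.norm_eq_abs]
  refine intervalIntegral.norm_integral_le_of_norm_le_const_ae ?_
  filter_upwards [Measure.ae_ne volume w] with s hsw hs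
  rw [uIoc_of_le huw] at hs
  exact h _ (hT.floor_mem_Ico hu ⟨hs.1.le, hs.2.lt_of_ne hsw⟩)

theorem abs_primitive_le_integral (hT : IsCompactScale T a b) (hg : MonotoneOn g (Ici a))
    (h : ∀ x ∈ T, |f x| ≤ g x) (ht : a ≤ t) :
    |primitive T a f t| ≤ ∫ s in a..t, g s := by
  rw [← Real.norm_eq_abs]
  refine intervalIntegral.norm_integral_le_of_norm_le ht (Eventually.of_forall fun s hs => ?_)
    (hg.mono (by rw [uIcc_of_le ht]; exact Icc_subset_Ici_self)).intervalIntegrable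
  exact (h _ (hT.floor_mem s)).trans
    (hg (hT.left_le (hT.floor_mem s)) hs.1.le (hT.floor_le hs.1.le))

theorem hasDeltaDerivAt_primitive (hT : IsCompactScale T a b) (hf : RdContinuousOn T T f)
    (ht : t ∈ T) : HasDeltaDerivAt T (primitive T a f) (f t) t := by
  refine (hasDeltaDerivAt_iff ht).2 ⟨(hT.continuous_primitive hf).continuousWithinAt, ?_,
    fun hσ => ?_⟩
  · have hjump := hT.abs_primitive_sub_le (l := f t) (ε := 0) hf ht (le_sigma ht) fun x hx => by
      have hxt : x = t :=
        hx.2.1.antisymm' (not_lt.1 fun htx => hx.2.2.not_ge (sigma_le hx.1 htx))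
      simp [hxt]
    rw [zero_mul, abs_nonpos_iff] at hjump
    linarith
  · rw [hasDerivWithinAt_iff_isLittleO, Asymptotics.isLittleO_iff]
    intro ε hε
    have hclose : ∀ᶠ x in 𝓝[T] t, |f x - f t| ≤ ε := by
      have := (((hf t ht).1 hσ).sub_const (f t)).abs
      rw [sub_self, abs_zero] at this
      exact this.eventually_le_const hε
    obtain ⟨l, u, htlu, hlu⟩ := mem_nhds_iff_exists_Ioo_subset.1
      (mem_nhdsWithin_iff_eventually.1 hclose)
    filter_upwards [self_mem_nhdsWithin, mem_nhdsWithin_of_mem_nhds (Ioo_mem_nhds htlu.1 htlu.2)]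
      with s hs hslu
    rw [Real.norm_eq_abs, Real.norm_eq_abs, smul_eq_mul, mul_comm]
    rcases le_total t s with hts | hst
    · rw [abs_of_nonneg (sub_nonneg.2 hts)]
      exact hT.abs_primitive_sub_le hf ht hts fun x hx =>
        hlu ⟨htlu.1.trans_le hx.2.1, hx.2.2.trans hslu.2⟩ hx.1
    · have := hT.abs_primitive_sub_le hf hs hst fun x hx =>
        hlu ⟨hslu.1.trans_le hx.2.1, hx.2.2.trans htlu.2⟩ hx.1
      rw [abs_sub_comm s t, abs_of_nonneg (sub_nonneg.2 hst), ← abs_neg]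
      convert this using 2
      ring

theorem primitive_inter_Iic (hT : IsCompactScale T a b) (hc : c ∈ T)
    (hfg : ∀ x ∈ T ∩ Iio c, f x = g x) (ht : t ∈ T) (htc : t ≤ c) :
    primitive (T ∩ Iic c) a f t = primitive T a g t := by
  refine intervalIntegral.integral_congr_ae ?_
  filter_upwards [Measure.ae_ne volume t] with s hst hs
  rw [uIoc_of_le (hT.left_le ht)] at hs
  have hsc : s < c := (hs.2.lt_of_ne hst).trans_le htc
  have hfloor : floor (T ∩ Iic c) a s = floor T a s := by
    rw [floor, floor, inter_assoc, Iic_inter_Iic, min_eq_right (max_le (hT.left_le hc) hsc.le)]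
  rw [hfloor]
  exact hfg _ ⟨hT.floor_mem s, (hT.floor_le hs.1.le).trans_lt hsc⟩

theorem deltaIntegral_eq_primitive (hT : IsCompactScale T a b) (hf : RdContinuousOn T T f) :
    deltaIntegral T a b f = primitive T a f b := by
  rw [hT.deltaIntegral_eq fun t ht => hT.hasDeltaDerivAt_primitive hf (hT.kappa_subset ht),
    primitive_left, sub_zero]

end IsCompactScale

end Primitive

namespace IsCompactScale

variable {T : Set ℝ} {f F η : ℝ → ℝ} {a b s t : ℝ}

theorem floor_eq_self (hT : IsCompactScale T a b) (ht : t ∈ T) : floor T a t = t :=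
  (hT.floor_le (hT.left_le ht)).antisymm (hT.le_floor ht le_rfl)

theorem eq_zero_of_isAntiderivative (hT : IsCompactScale T a b) (hab : a < b)
    (hF : IsAntiderivative T f F) (hf : ∀ t ∈ kappa T, 0 ≤ f t) (hle : F b ≤ F a)
    (ht : t ∈ kappa T) : f t = 0 := by
  have hmono {u w : ℝ} (hu : u ∈ T) (hw : w ∈ T) (huw : u ≤ w) : F u ≤ F w := by
    simpa using hT.mul_sub_le_sub hF hf hu hw huw
  have hconst : EqOn (fun _ => F a) F T := fun s hs =>
    (hmono hT.left_mem hs (hT.left_le hs)).antisymm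
      ((hmono hs hT.right_mem (hT.le_right hs)).trans hle)
  have htT := hT.kappa_subset ht
  exact ((hF t ht).congr hT.isClosed htT hconst).unique htT (hT.accPt_of_sigma_eq hab ht)
    (hasDeltaDerivAt_const _)

theorem eqOn_zero_of_comp_sigma (hT : IsCompactScale T a b) (hη : ContinuousOn η T)
    (ha : η a = 0) (hσ : ∀ t ∈ kappa T, η (sigma T t) = 0) : EqOn η 0 T := by
  intro t ht
  rcases (hT.left_le ht).eq_or_lt with rfl | hat
  · exact ha
  have hzero : ∀ᶠ s in 𝓝[<] t, η (sigma T (floor T a s)) = 0 := by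
    filter_upwards [Ioo_mem_nhdsLT hat] with s hs
    exact hσ _ (hT.mem_kappa_of_lt (hT.floor_mem s)
      ((hT.floor_le hs.1.le).trans_lt (hs.2.trans_le (hT.le_right ht))))
  have hbetween : ∀ᶠ s in 𝓝[<] t, s ≤ sigma T (floor T a s) ∧ sigma T (floor T a s) ≤ t := by
    filter_upwards [Ioo_mem_nhdsLT hat] with s hs
    exact ⟨hT.le_sigma_floor (hs.2.le.trans (hT.le_right ht)),
      sigma_le ht ((hT.floor_le hs.1.le).trans_lt hs.2)⟩
  have hlim : Tendsto (fun s => sigma T (floor T a s)) (𝓝[<] t) (𝓝[T] t) :=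
    tendsto_nhdsWithin_iff.2 ⟨tendsto_of_tendsto_of_tendsto_of_le_of_le'
      (tendsto_nhdsWithin_of_tendsto_nhds tendsto_id) tendsto_const_nhds
      (hbetween.mono fun _ h => h.1) (hbetween.mono fun _ h => h.2),
      Eventually.of_forall fun s => sigma_mem hT.isClosed (hT.floor_mem s)⟩
  exact tendsto_nhds_unique ((hη t ht).tendsto.comp hlim)
    (tendsto_const_nhds.congr' (hzero.mono fun _ h => h.symm))

end IsCompactScale

/-- `y` solves the initial value problem `y^ΔΔ + (q + lam) y^σ = 0`, `y a = 0`, `y^Δ a = c` on `T`,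
with `v = y^Δ`. The equation is encoded by integration, so that it passes to the initial segments
of `T`, in particular to `T^κ`. -/
structure IsShootingSolution (T : Set ℝ) (a c : ℝ) (q : ℝ → ℝ) (lam : ℝ) (y v : ℝ → ℝ) :
    Prop where
  continuousOn : ContinuousOn y T
  eq_primitive : ∀ t ∈ T, y t = primitive T a v t
  deriv_eq : ∀ t ∈ T, v t = c - primitive T a (fun s => (q s + lam) * y (sigma T s)) t

namespace IsShootingSolution

variable {T : Set ℝ} {q y v : ℝ → ℝ} {a b c k lam t : ℝ}

theorem left_eq_zero (hT : IsCompactScale T a b) (h : IsShootingSolution T a c q lam y v) :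
    y a = 0 := by
  rw [h.eq_primitive a hT.left_mem, primitive_left]

theorem deriv_left (hT : IsCompactScale T a b) (h : IsShootingSolution T a c q lam y v) :
    v a = c := by
  rw [h.deriv_eq a hT.left_mem, primitive_left, sub_zero]

theorem rdContinuousOn (hT : IsCompactScale T a b) (hq : ContinuousOn q T)
    (h : IsShootingSolution T a c q lam y v) :
    RdContinuousOn T T fun s => (q s + lam) * y (sigma T s) :=
  (rdContinuousOn_of_continuousOn (hq.add continuousOn_const)).mul
    (rdContinuousOn_comp_sigma hT.isClosed h.continuousOn)

theorem continuousOn_deriv (hT : IsCompactScale T a b) (hq : ContinuousOn q T)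
    (h : IsShootingSolution T a c q lam y v) : ContinuousOn v T :=
  (continuousOn_const.sub
    (hT.continuous_primitive (h.rdContinuousOn hT hq)).continuousOn).congr h.deriv_eq

theorem hasDeltaDerivAt (hT : IsCompactScale T a b) (hq : ContinuousOn q T)
    (h : IsShootingSolution T a c q lam y v) (ht : t ∈ T) : HasDeltaDerivAt T y (v t) t :=
  (hT.hasDeltaDerivAt_primitive
    (rdContinuousOn_of_continuousOn (h.continuousOn_deriv hT hq)) ht).congr hT.isClosed ht
    h.eq_primitive

theorem hasDeltaDerivAt_deriv (hT : IsCompactScale T a b) (hq : ContinuousOn q T)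
    (h : IsShootingSolution T a c q lam y v) (ht : t ∈ T) :
    HasDeltaDerivAt T v (-((q t + lam) * y (sigma T t))) t := by
  simpa only [zero_sub] using ((hasDeltaDerivAt_const c).sub
    (hT.hasDeltaDerivAt_primitive (h.rdContinuousOn hT hq) ht)).congr hT.isClosed ht h.deriv_eq

theorem const_mul (h : IsShootingSolution T a c q lam y v) (k : ℝ) :
    IsShootingSolution T a (k * c) q lam (fun t => k * y t) (fun t => k * v t) where
  continuousOn := continuousOn_const.mul h.continuousOn
  eq_primitive t ht := by rw [h.eq_primitive t ht, primitive_const_mul]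
  deriv_eq t ht := by
    simp only [mul_left_comm _ k]
    rw [h.deriv_eq t ht, primitive_const_mul, mul_sub]

theorem inter_Iic (hT : IsCompactScale T a b) (hk : k ∈ T)
    (h : IsShootingSolution T a c q lam y v) : IsShootingSolution (T ∩ Iic k) a c q lam y v where
  continuousOn := h.continuousOn.mono inter_subset_left
  eq_primitive t ht := by
    rw [h.eq_primitive t ht.1, hT.primitive_inter_Iic hk (fun _ _ => rfl) ht.1 ht.2]
  deriv_eq t ht := by
    have hσ : ∀ s ∈ T ∩ Iio k, (q s + lam) * y (sigma (T ∩ Iic k) s)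
        = (q s + lam) * y (sigma T s) := fun s hs => by
      rw [sigma_inter_Iic hT.isClosed hs.1 (sigma_le hk hs.2)]
    rw [h.deriv_eq t ht.1, hT.primitive_inter_Iic hk hσ ht.1 ht.2]

end IsShootingSolution

section InitialValueProblem

theorem isUnit_one_sub_of_norm_pow_lt_one {R : Type*} [NormedRing R] [HasSummableGeomSeries R]
    {x : R} {n : ℕ} (h : ‖x ^ n‖ < 1) : IsUnit (1 - x) := by
  have hcomm : Commute (1 - x) (∑ i ∈ Finset.range n, x ^ i) :=
    (mul_neg_geom_sum x n).trans (geom_sum_mul_neg x n).symm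
  have hunit := isUnit_one_sub_of_norm_lt_one h
  rw [← mul_neg_geom_sum, hcomm.isUnit_mul_iff] at hunit
  exact hunit.1

theorem exists_continuous_forall_eq_add_apply {X E : Type*} [TopologicalSpace X]
    [NormedAddCommGroup E] [NormedSpace ℝ E] [CompleteSpace E] {L : X → E →L[ℝ] E}
    (hL : Continuous L) (hunit : ∀ x, IsUnit (1 - L x)) (e : E) :
    ∃ V : X → E, Continuous V ∧ ∀ x, V x = e + L x (V x) := by
  refine ⟨fun x => Ring.inverse (1 - L x) e, ?_, fun x => ?_⟩
  · refine Continuous.clm_apply (continuous_iff_continuousAt.2 fun x => ?_) continuous_const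
    obtain ⟨u, hu⟩ := hunit x
    have hinv : ContinuousAt Ring.inverse (1 - L x) := hu ▸
      NormedRing.inverse_continuousAt (R := E →L[ℝ] E) u
    exact hinv.comp (f := fun x => 1 - L x) (continuous_const.sub hL).continuousAt
  · have hsolve : Ring.inverse (1 - L x) e - L x (Ring.inverse (1 - L x) e) = e :=
      DFunLike.congr_fun (Ring.mul_inverse_cancel _ (hunit x)) e
    exact sub_eq_iff_eq_add.1 hsolve

namespace IsCompactScale

variable {T : Set ℝ} {f g p q τ : ℝ → ℝ} {a b t M : ℝ}

/-- The floor map as a retraction of `ℝ` onto `T`; it extends functions on `T` to `ℝ`. -/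
noncomputable def retract (hT : IsCompactScale T a b) (s : ℝ) : T := ⟨floor T a s, hT.floor_mem s⟩

theorem retract_eq_self (hT : IsCompactScale T a b) (ht : t ∈ T) : hT.retract t = ⟨t, ht⟩ :=
  Subtype.ext (hT.floor_eq_self ht)

theorem continuousOn_retract (hT : IsCompactScale T a b) : ContinuousOn hT.retract T :=
  IsInducing.subtypeVal.continuousOn_iff.2 (continuousOn_id.congr fun _ ht => hT.floor_eq_self ht)

theorem continuousOn_comp_retract (hT : IsCompactScale T a b) (z : C(T, ℝ)) :
    ContinuousOn (fun s => z (hT.retract s)) T :=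
  z.continuous.comp_continuousOn hT.continuousOn_retract

theorem continuousOn_uncurry_retract [CompactSpace T] (hT : IsCompactScale T a b)
    {V : ℝ → C(T, ℝ)} (hV : Continuous V) :
    ContinuousOn (Function.uncurry fun lam s => V lam (hT.retract s)) (univ ×ˢ T) :=
  (show Continuous fun p : ℝ × T => V p.1 p.2 by fun_prop).comp_continuousOn
    (continuousOn_fst.prodMk (hT.continuousOn_retract.comp continuousOn_snd fun _ hp => hp.2))

theorem exists_clm_primitive [CompactSpace T] (hT : IsCompactScale T a b) (hp : ContinuousOn p T)
    (hτ : ∀ z : C(T, ℝ), RdContinuousOn T T fun s => z (hT.retract (τ s))) :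
    ∃ L : C(T, ℝ) →L[ℝ] C(T, ℝ),
      ∀ z t, L z t = primitive T a (fun s => p s * z (hT.retract (τ s))) t := by
  have hrd (z : C(T, ℝ)) : RdContinuousOn T T fun s => p s * z (hT.retract (τ s)) :=
    (rdContinuousOn_of_continuousOn hp).mul (hτ z)
  obtain ⟨M, hM⟩ := hT.isCompact.exists_bound_of_continuousOn hp
  have hM0 : 0 ≤ M := (norm_nonneg _).trans (hM a hT.left_mem)
  let L : C(T, ℝ) →ₗ[ℝ] C(T, ℝ) :=
    { toFun := fun z => ⟨fun t => primitive T a (fun s => p s * z (hT.retract (τ s))) t,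
        (hT.continuous_primitive (hrd z)).comp continuous_subtype_val⟩
      map_add' := fun y z => by
        ext t
        exact (congrArg (primitive T a · t) (funext fun _ => mul_add _ _ _)).trans
          (hT.primitive_add (hrd y) (hrd z) t)
      map_smul' := fun c z => by
        ext t
        exact (congrArg (primitive T a · t) (funext fun _ => mul_left_comm _ _ _)).trans
          (primitive_const_mul c (fun s => p s * z (hT.retract (τ s))) t) }
  refine ⟨L.mkContinuous (M * (b - a)) fun z => ?_, fun _ _ => rfl⟩
  have hba := sub_nonneg.2 hT.left_le_right
  rw [ContinuousMap.norm_le _ (by positivity)]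
  intro t
  have hbound : ∀ x ∈ T, |p x * z (hT.retract (τ x))| ≤ M * ‖z‖ := fun x hx => by
    rw [abs_mul]
    exact mul_le_mul (hM x hx) (z.norm_coe_le_norm _) (abs_nonneg _) hM0
  calc ‖L z t‖ ≤ ∫ _ in a..t, M * ‖z‖ :=
        hT.abs_primitive_le_integral monotoneOn_const hbound (hT.left_le t.2)
    _ = (t - a) * (M * ‖z‖) := by rw [intervalIntegral.integral_const, smul_eq_mul]
    _ ≤ (b - a) * (M * ‖z‖) := by gcongr; exact hT.le_right t.2
    _ = M * (b - a) * ‖z‖ := by ring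

theorem abs_primitive_primitive_le (hT : IsCompactScale T a b) (hf : RdContinuousOn T T f)
    (hg : MonotoneOn g (Ici a)) (hfg : ∀ x ∈ T, |f x| ≤ g x) (hp : ∀ x ∈ T, |p x| ≤ M)
    (ht : t ∈ T) :
    |primitive T a (fun s => p s * primitive T a f (sigma T s)) t|
      ≤ ∫ s in a..t, M * (b - a) * g s := by
  have hM0 : 0 ≤ M := (abs_nonneg _).trans (hp a hT.left_mem)
  have hK : 0 ≤ M * (b - a) := mul_nonneg hM0 (sub_nonneg.2 hT.left_le_right)
  have hσ : ∀ x ∈ T, |primitive T a f (sigma T x)| ≤ g x * (b - a) := fun x hx => by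
    have hax := hT.left_le hx
    have hg0 : 0 ≤ g x := (abs_nonneg _).trans (hfg x hx)
    have hbound := hT.abs_primitive_sub_le (l := 0) (ε := g x) hf hT.left_mem
      (hax.trans (le_sigma hx)) fun s hs => by
        have hsx : s ≤ x := not_lt.1 fun hxs => hs.2.2.not_ge (sigma_le hs.1 hxs)
        simpa using (hfg s hs.1).trans (hg hs.2.1 hax hsx)
    rw [primitive_left, zero_mul, sub_zero,
      sub_zero] at hbound
    exact hbound.trans (mul_le_mul_of_nonneg_left
      (sub_le_sub_right (hT.le_right (sigma_mem hT.isClosed hx)) a) hg0)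
  refine hT.abs_primitive_le_integral (fun x hx y hy hxy => mul_le_mul_of_nonneg_left
    (hg hx hy hxy) hK) (fun x hx => ?_) (hT.left_le ht)
  rw [abs_mul]
  calc |p x| * |primitive T a f (sigma T x)| ≤ M * (g x * (b - a)) :=
        mul_le_mul (hp x hx) (hσ x hx) (abs_nonneg _) hM0
    _ = M * (b - a) * g x := by ring

theorem abs_pow_apply_le [CompactSpace T] (hT : IsCompactScale T a b) (hp : ∀ x ∈ T, |p x| ≤ M)
    {L : C(T, ℝ) →L[ℝ] C(T, ℝ)}
    (hL : ∀ z t, L z t = -primitive T a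
      (fun s => p s * primitive T a (fun x => z (hT.retract x)) (sigma T s)) t)
    (n : ℕ) (z : C(T, ℝ)) (t : T) :
    |(L ^ n) z t| ≤ ‖z‖ * ((M * (b - a)) ^ n / n.factorial) * (t - a) ^ n := by
  have hK : 0 ≤ M * (b - a) :=
    mul_nonneg ((abs_nonneg _).trans (hp a hT.left_mem)) (sub_nonneg.2 hT.left_le_right)
  induction n generalizing t with
  | zero => simpa using z.norm_coe_le_norm t
  | succ n ih =>
    set C : ℝ := ‖z‖ * ((M * (b - a)) ^ n / n.factorial)
    have hC : 0 ≤ C := by positivity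
    have hmono : MonotoneOn (fun s => C * (s - a) ^ n) (Ici a) := fun x hx y _ hxy =>
      mul_le_mul_of_nonneg_left
        (pow_le_pow_left₀ (sub_nonneg.2 hx) (sub_le_sub_right hxy a) n) hC
    rw [pow_succ', mul_apply_eq_comp, hL, abs_neg]
    refine (hT.abs_primitive_primitive_le
      (rdContinuousOn_of_continuousOn (hT.continuousOn_comp_retract _)) hmono
      (fun x hx => by simpa only [hT.retract_eq_self hx] using ih ⟨x, hx⟩) hp t.2).trans_eq ?_
    simp only [intervalIntegral.integral_const_mul,
      intervalIntegral.integral_comp_sub_right (fun s => s ^ n), integral_pow, sub_self,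
      Nat.factorial_succ, C]
    push_cast
    field_simp
    ring

theorem isUnit_one_sub [CompactSpace T] (hT : IsCompactScale T a b) (hp : ∀ x ∈ T, |p x| ≤ M)
    {L : C(T, ℝ) →L[ℝ] C(T, ℝ)}
    (hL : ∀ z t, L z t = -primitive T a
      (fun s => p s * primitive T a (fun x => z (hT.retract x)) (sigma T s)) t) :
    IsUnit (1 - L) := by
  have hba := sub_nonneg.2 hT.left_le_right
  have hM0 : 0 ≤ M := (abs_nonneg _).trans (hp a hT.left_mem)
  have hnorm (n : ℕ) : ‖L ^ n‖ ≤ (M * (b - a) * (b - a)) ^ n / n.factorial := by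
    refine ContinuousLinearMap.opNorm_le_bound _ (by positivity) fun z => ?_
    rw [ContinuousMap.norm_le _ (by positivity)]
    intro t
    have hat := sub_nonneg.2 (hT.left_le t.2)
    calc ‖(L ^ n) z t‖ ≤ ‖z‖ * ((M * (b - a)) ^ n / n.factorial) * (t - a) ^ n :=
          hT.abs_pow_apply_le hp hL n z t
      _ ≤ ‖z‖ * ((M * (b - a)) ^ n / n.factorial) * (b - a) ^ n := by
          gcongr; exact hT.le_right t.2
      _ = (M * (b - a) * (b - a)) ^ n / n.factorial * ‖z‖ := by rw [mul_pow (M * (b - a))]; ring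
  obtain ⟨n, hn⟩ := ((FloorSemiring.tendsto_pow_div_factorial_atTop
    (M * (b - a) * (b - a))).eventually_lt_const one_pos).exists
  exact isUnit_one_sub_of_norm_pow_lt_one (R := C(T, ℝ) →L[ℝ] C(T, ℝ)) ((hnorm n).trans_lt hn)

theorem rdContinuousOn_comp_retract_sigma (hT : IsCompactScale T a b) (z : C(T, ℝ)) :
    RdContinuousOn T T fun s => z (hT.retract (sigma T s)) :=
  rdContinuousOn_comp_sigma hT.isClosed (hT.continuousOn_comp_retract z)

theorem exists_continuous_clm_primitive [CompactSpace T] (hT : IsCompactScale T a b)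
    (hq : ContinuousOn q T) :
    ∃ A : ℝ → C(T, ℝ) →L[ℝ] C(T, ℝ), Continuous A ∧ ∀ lam z t,
      A lam z t = primitive T a (fun s => (q s + lam) * z (hT.retract (sigma T s))) t := by
  have hσ := hT.rdContinuousOn_comp_retract_sigma
  obtain ⟨A, hA⟩ := hT.exists_clm_primitive hq hσ
  obtain ⟨B, hB⟩ := hT.exists_clm_primitive (p := 1) continuousOn_const hσ
  simp only [Pi.one_apply, one_mul] at hB
  refine ⟨fun lam => A + lam • B,
    continuous_const.add (continuous_id.smul continuous_const), fun lam z t => ?_⟩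
  simp only [add_mul]
  rw [hT.primitive_add ((rdContinuousOn_of_continuousOn hq).mul (hσ z))
    ((rdContinuousOn_of_continuousOn continuousOn_const).mul (hσ z)), primitive_const_mul,
    ← hA, ← hB]
  rfl

theorem exists_isShootingSolution (hT : IsCompactScale T a b) (hq : ContinuousOn q T) :
    ∃ y v : ℝ → ℝ → ℝ, (∀ lam, IsShootingSolution T a 1 q lam (y lam) (v lam)) ∧
      ContinuousOn (Function.uncurry y) (univ ×ˢ T) ∧
      ContinuousOn (Function.uncurry v) (univ ×ˢ T) := by
  have := isCompact_iff_compactSpace.1 hT.isCompact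
  obtain ⟨R, hR⟩ := hT.exists_clm_primitive (p := 1) continuousOn_const fun z =>
    rdContinuousOn_of_continuousOn (hT.continuousOn_comp_retract z)
  simp only [Pi.one_apply, one_mul] at hR
  obtain ⟨A, hAc, hA⟩ := hT.exists_continuous_clm_primitive hq
  have hunit (lam : ℝ) : IsUnit (1 - -(A lam * R)) := by
    obtain ⟨M, hM⟩ := hT.isCompact.exists_bound_of_continuousOn (hq.add continuousOn_const)
    refine hT.isUnit_one_sub (p := fun s => q s + lam) hM fun z t => ?_
    rw [neg_apply, mul_apply_eq_comp, ContinuousMap.neg_apply, hA, neg_inj]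
    refine hT.primitive_congr (fun s hs => ?_) t
    rw [hR, hT.retract_eq_self (sigma_mem hT.isClosed hs)]
  -- In terms of `v = y^Δ` the initial value problem is the integral equation `v = 1 - A R v`.
  obtain ⟨V, hV, hVeq⟩ := exists_continuous_forall_eq_add_apply
    (hAc.clm_comp continuous_const).neg hunit (1 : C(T, ℝ))
  refine ⟨fun lam s => R (V lam) (hT.retract s), fun lam s => V lam (hT.retract s),
    fun lam => ⟨hT.continuousOn_comp_retract _, fun t ht => ?_, fun t ht => ?_⟩,
    hT.continuousOn_uncurry_retract (R.continuous.comp hV), hT.continuousOn_uncurry_retract hV⟩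
  · simp only [hT.retract_eq_self ht, hR]
  · have hVt := DFunLike.congr_fun (hVeq lam) ⟨t, ht⟩
    simp only [hT.retract_eq_self ht, ← hA lam _ ⟨t, ht⟩]
    exact hVt.trans (sub_eq_add_neg _ _).symm

end IsCompactScale

end InitialValueProblem

section Picone

variable {T : Set ℝ} {f q y v η g F : ℝ → ℝ} {a b d e lam r t : ℝ}

theorem HasDeltaDerivAt.picone (ht : t ∈ T) (hη : HasDeltaDerivAt T η d t)
    (hy : HasDeltaDerivAt T y (v t) t) (hv : HasDeltaDerivAt T v (-(r * y (sigma T t))) t)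
    (hyt : y t ≠ 0) (hyσ : y (sigma T t) ≠ 0) :
    HasDeltaDerivAt T (fun s => η s ^ 2 * v s / y s)
      (d ^ 2 - r * η (sigma T t) ^ 2
        - (d * y t - η t * v t) ^ 2 / (y t * y (sigma T t))) t := by
  have hηv := ((hη.mul ht hη).mul ht hv).div ht hy hyt hyσ
  have hηjump := hη.sub_eq ht
  have hyjump := hy.sub_eq ht
  simp only [← sq] at hηv
  convert hηv using 1
  rw [sub_eq_iff_eq_add.1 hηjump] at *
  field_simp
  rw [sub_eq_iff_eq_add.1 hyjump]
  ring

theorem tendsto_picone_left (hη : HasDerivWithinAt η d (T ∩ Ioi a) a)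
    (hy : HasDerivWithinAt y e (T ∩ Ioi a) a) (hv : ContinuousWithinAt v (T ∩ Ioi a) a)
    (hηa : η a = 0) (hya : y a = 0) (he : e ≠ 0) :
    Tendsto (fun s => η s ^ 2 * v s / y s) (𝓝[T ∩ Ioi a] a) (𝓝 0) := by
  have ha : a ∉ T ∩ Ioi a := fun h => lt_irrefl a h.2
  have hlim := ((((hasDerivWithinAt_iff_tendsto_slope' ha).1 hη).mul hη.continuousWithinAt).mul
    hv).div ((hasDerivWithinAt_iff_tendsto_slope' ha).1 hy) he
  rw [hηa, mul_zero, zero_mul, zero_div] at hlim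
  refine hlim.congr' ?_
  filter_upwards [self_mem_nhdsWithin] with s hs
  have hsa : s - a ≠ 0 := (sub_pos.2 hs.2).ne'
  simp only [Pi.div_apply, slope_def_field, hηa, hya, sub_zero]
  field_simp

namespace IsShootingSolution

theorem sub_picone_le (hT : IsCompactScale T a b) (hq : ContinuousOn q T)
    (h : IsShootingSolution T a 1 q lam y v) (hpos : ∀ t ∈ T, a < t → 0 < y t)
    (hη : ∀ t ∈ kappa T, HasDeltaDerivAt T η (g t) t) (hηb : η b = 0)
    (hF : IsAntiderivative T (fun t => g t ^ 2 - (q t + lam) * η (sigma T t) ^ 2) F)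
    (ht : t ∈ T) (hat : a < t) : F t - η t ^ 2 * v t / y t ≤ F b := by
  have hpos' : ∀ s ∈ T, t ≤ s → 0 < y s := fun s hs hts => hpos s hs (hat.trans_le hts)
  have hcont : ContinuousOn (fun s => F s - η s ^ 2 * v s / y s) (T ∩ Icc t b) := by
    have hηc := hT.continuousOn_of_hasDeltaDerivAt hη
    have hFc := hT.continuousOn_of_hasDeltaDerivAt hF
    exact (hFc.mono inter_subset_left).sub (((((hηc.pow 2).mul
      (h.continuousOn_deriv hT hq)).mono inter_subset_left)).div
      (h.continuousOn.mono inter_subset_left) fun s hs => (hpos' s hs.1 hs.2.1).ne')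
  have hderiv : ∀ s ∈ T ∩ Ico t b, HasDeltaDerivAt T (fun s => F s - η s ^ 2 * v s / y s)
      ((g s * y s - η s * v s) ^ 2 / (y s * y (sigma T s))) s := fun s hs => by
    have hsκ := hT.mem_kappa_of_lt hs.1 hs.2.2
    convert (hF s hsκ).sub ((hη s hsκ).picone hs.1 (h.hasDeltaDerivAt hT hq hs.1)
      (h.hasDeltaDerivAt_deriv hT hq hs.1) (hpos' s hs.1 hs.2.1).ne'
      (hpos' _ (sigma_mem hT.isClosed hs.1) (hs.2.1.trans (le_sigma hs.1))).ne') using 1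
    ring
  have hle := mul_sub_le_sub_of_le_deltaDeriv (c := 0) hT.isClosed ht hT.right_mem
    (hT.le_right ht) hcont hderiv fun s hs => div_nonneg (sq_nonneg _)
      (mul_pos (hpos' s hs.1 hs.2.1) (hpos' _ (sigma_mem hT.isClosed hs.1)
        (hs.2.1.trans (le_sigma hs.1)))).le
  rw [hηb, zero_mul, zero_pow two_ne_zero, zero_mul, zero_div, sub_zero] at hle
  exact sub_nonneg.1 hle

theorem le_of_isAntiderivative_picone (hT : IsCompactScale T a b) (hab : a < b)
    (hq : ContinuousOn q T) (h : IsShootingSolution T a 1 q lam y v)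
    (hpos : ∀ t ∈ T, a < t → 0 < y t) (hη : ∀ t ∈ kappa T, HasDeltaDerivAt T η (g t) t)
    (hηa : η a = 0) (hηb : η b = 0)
    (hF : IsAntiderivative T (fun t => g t ^ 2 - (q t + lam) * η (sigma T t) ^ 2) F) :
    F a ≤ F b := by
  have ha := hT.left_mem
  have haκ := hT.mem_kappa_of_lt ha hab
  have hle {t : ℝ} (ht : t ∈ T) (hat : a < t) : F t - η t ^ 2 * v t / y t ≤ F b :=
    h.sub_picone_le hT hq hpos hη hηb hF ht hat
  have hya := h.left_eq_zero hT
  have hva := h.deriv_left hT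
  have hy' : HasDeltaDerivAt T y 1 a := hva ▸ h.hasDeltaDerivAt hT hq ha
  rcases (le_sigma ha).eq_or_lt with hσ | hσ
  · have hdense {f : ℝ → ℝ} {d : ℝ} : HasDeltaDerivAt T f d a ↔ HasDerivWithinAt f d T a :=
      hasDeltaDerivAt_iff_of_eq hσ.symm
    have hΦ := tendsto_picone_left (((hdense.1 (hη a haκ)).mono inter_subset_left))
      ((hdense.1 hy').mono inter_subset_left)
      ((h.continuousOn_deriv hT hq a ha).mono inter_subset_left) hηa hya one_ne_zero
    have hFa : ContinuousWithinAt F (T ∩ Ioi a) a :=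
      (hdense.1 (hF a haκ)).continuousWithinAt.mono inter_subset_left
    have hlim := hFa.tendsto.sub hΦ
    rw [sub_zero] at hlim
    have := neBot_nhdsWithin_Ioi_of_sigma_eq hσ.symm hT.right_mem hab
    exact le_of_tendsto hlim (eventually_nhdsWithin_of_forall fun s hs => hle hs.1 hs.2)
  · refine le_trans (le_of_eq ?_) (hle (sigma_mem hT.isClosed ha) hσ)
    have hηjump := (hη a haκ).sub_eq ha
    have hyjump := hy'.sub_eq ha
    have hvjump := (h.hasDeltaDerivAt_deriv hT hq ha).sub_eq ha
    have hFjump := (hF a haκ).sub_eq ha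
    beta_reduce at hFjump
    have hμ : sigma T a - a ≠ 0 := (sub_pos.2 hσ).ne'
    rw [hηa, sub_zero] at hηjump
    rw [hya, sub_zero, one_mul] at hyjump
    rw [sub_eq_iff_eq_add.1 hFjump, sub_eq_iff_eq_add.1 hvjump, hηjump, hyjump, hva]
    field_simp
    ring

end IsShootingSolution

/-- `lam` bounds the Rayleigh quotient `∫ ((η^Δ)² - q (η^σ)²) / ∫ (η^σ)²` from below over all `η`
with rd-continuous delta derivative `g` that vanish at `a` and `b`. -/
def IsRayleighLowerBound (T : Set ℝ) (a b : ℝ) (q : ℝ → ℝ) (lam : ℝ) : Prop :=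
  ∀ η g : ℝ → ℝ, (∀ t ∈ kappa T, HasDeltaDerivAt T η (g t) t) → RdContinuousOn T T g →
    η a = 0 → η b = 0 → lam * deltaIntegral T a b (fun t => η (sigma T t) ^ 2)
      ≤ deltaIntegral T a b fun t => g t ^ 2 - q t * η (sigma T t) ^ 2

theorem IsCompactScale.deltaIntegral_sq_sub_mul_sq (hT : IsCompactScale T a b)
    (hq : ContinuousOn q T) (hg : RdContinuousOn T T g) (hη : ContinuousOn η T) (lam : ℝ) :
    deltaIntegral T a b (fun t => g t ^ 2 - q t * η (sigma T t) ^ 2)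
      = deltaIntegral T a b (fun t => g t ^ 2 - (q t + lam) * η (sigma T t) ^ 2)
        + lam * deltaIntegral T a b fun t => η (sigma T t) ^ 2 := by
  have hησ : RdContinuousOn T T fun t => η (sigma T t) ^ 2 :=
    (rdContinuousOn_comp_sigma hT.isClosed hη).pow 2
  have hrd {p : ℝ → ℝ} (hp : ContinuousOn p T) :
      RdContinuousOn T T fun t => g t ^ 2 - p t * η (sigma T t) ^ 2 :=
    (hg.pow 2).sub ((rdContinuousOn_of_continuousOn hp).mul hησ)
  have hrdlam := hrd (p := fun t => q t + lam) (hq.add continuousOn_const)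
  have hsplit : EqOn (fun t => g t ^ 2 - q t * η (sigma T t) ^ 2)
      (fun t => (g t ^ 2 - (q t + lam) * η (sigma T t) ^ 2) + lam * η (sigma T t) ^ 2) T :=
    fun t _ => by ring
  rw [hT.deltaIntegral_eq_primitive hησ, hT.deltaIntegral_eq_primitive (hrd hq),
    hT.deltaIntegral_eq_primitive hrdlam, hT.primitive_congr hsplit, hT.primitive_add hrdlam
      ((rdContinuousOn_of_continuousOn continuousOn_const).mul hησ), primitive_const_mul]

theorem IsShootingSolution.isRayleighLowerBound (hT : IsCompactScale T a b) (hab : a < b)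
    (hq : ContinuousOn q T) (h : IsShootingSolution T a 1 q lam y v)
    (hpos : ∀ t ∈ T, a < t → 0 < y t) : IsRayleighLowerBound T a b q lam := by
  intro η g hη hg hηa hηb
  have hηc := hT.continuousOn_of_hasDeltaDerivAt hη
  have hrd : RdContinuousOn T T fun t => g t ^ 2 - (q t + lam) * η (sigma T t) ^ 2 :=
    (hg.pow 2).sub ((rdContinuousOn_of_continuousOn (hq.add continuousOn_const)).mul
      ((rdContinuousOn_comp_sigma hT.isClosed hηc).pow 2))
  have hle := h.le_of_isAntiderivative_picone hT hab hq hpos hη hηa hηb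
    fun t ht => hT.hasDeltaDerivAt_primitive hrd (hT.kappa_subset ht)
  rw [primitive_left] at hle
  rw [hT.deltaIntegral_sq_sub_mul_sq hq hg hηc lam, hT.deltaIntegral_eq_primitive hrd]
  exact le_add_of_nonneg_left hle

end Picone

section Positivity

variable {T : Set ℝ} {q y v z w η : ℝ → ℝ} {a b c k lam mu t : ℝ}

theorem IsCompactScale.deltaIntegral_sq_pos (hT : IsCompactScale T a b) (hab : a < b)
    (hη : ContinuousOn η T) (hηa : η a = 0) (hne : ∃ t ∈ T, η t ≠ 0) :
    0 < deltaIntegral T a b fun t => η (sigma T t) ^ 2 := by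
  have hrd : RdContinuousOn T T fun t => η (sigma T t) ^ 2 :=
    (rdContinuousOn_comp_sigma hT.isClosed hη).pow 2
  rw [hT.deltaIntegral_eq_primitive hrd]
  by_contra! hle
  obtain ⟨t, ht, hηt⟩ := hne
  refine hηt (hT.eqOn_zero_of_comp_sigma hη hηa (fun s hs => ?_) ht)
  have hF : IsAntiderivative T (fun t => η (sigma T t) ^ 2)
      (primitive T a fun t => η (sigma T t) ^ 2) := fun x hx =>
    hT.hasDeltaDerivAt_primitive hrd (hT.kappa_subset hx)
  have hsq := hT.eq_zero_of_isAntiderivative hab hF (fun _ _ => sq_nonneg _)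
    (hle.trans_eq primitive_left.symm) hs
  exact pow_eq_zero_iff two_ne_zero |>.1 hsq

theorem IsCompactScale.bddAbove_setOf_isRayleighLowerBound (hT : IsCompactScale T a b)
    (hm : (T ∩ Ioo a b).Nonempty) : BddAbove {lam | IsRayleighLowerBound T a b q lam} := by
  obtain ⟨m, hmT, ham, hmb⟩ := hm
  have hη : ∀ t ∈ kappa T, HasDeltaDerivAt T (fun t => (t - a) * (b - t))
      ((b - t) - (sigma T t - a)) t := fun t ht => by
    convert (hasDeltaDerivAt_id.sub (hasDeltaDerivAt_const a)).mul (hT.kappa_subset ht)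
      ((hasDeltaDerivAt_const b).sub hasDeltaDerivAt_id) using 1
    ring
  have hg : RdContinuousOn T T fun t => (b - t) - (sigma T t - a) :=
    (rdContinuousOn_of_continuousOn (f := fun t => b - t) (by fun_prop)).sub
      (rdContinuousOn_comp_sigma (f := fun t => t - a) hT.isClosed (by fun_prop))
  have hpos := hT.deltaIntegral_sq_pos (ham.trans hmb) (hT.continuousOn_of_hasDeltaDerivAt hη)
    (by ring) ⟨m, hmT, (mul_pos (sub_pos.2 ham) (sub_pos.2 hmb)).ne'⟩
  exact ⟨_, fun lam hlam => (le_div_iff₀ hpos).2 (hlam _ _ hη hg (by ring) (by ring))⟩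

theorem isClosed_setOf_isRayleighLowerBound :
    IsClosed {lam | IsRayleighLowerBound T a b q lam} := by
  simp only [IsRayleighLowerBound, ofPred_forall]
  exact isClosed_iInter fun η => isClosed_iInter fun g => isClosed_iInter fun _ =>
    isClosed_iInter fun _ => isClosed_iInter fun _ => isClosed_iInter fun _ =>
      isClosed_le (continuous_id.mul continuous_const) continuous_const

namespace IsShootingSolution

theorem mul_sub_le (hT : IsCompactScale T a b) (hq : ContinuousOn q T)
    (h : IsShootingSolution T a c q lam y v) (ht : t ∈ T) (hk : ∀ s ∈ T ∩ Ico a t, k ≤ v s) :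
    k * (t - a) ≤ y t := by
  have hle := mul_sub_le_sub_of_le_deltaDeriv hT.isClosed hT.left_mem ht (hT.left_le ht)
    (h.continuousOn.mono inter_subset_left) (fun s hs => h.hasDeltaDerivAt hT hq hs.1) hk
  rwa [h.left_eq_zero hT, sub_zero] at hle

theorem pos_of_nonpos (hT : IsCompactScale T a b) (hq : ContinuousOn q T)
    (h : IsShootingSolution T a c q lam y v) (hc : 0 < c) (hneg : ∀ t ∈ T, q t + lam ≤ 0)
    (ht : t ∈ T) (hat : a < t) : 0 < y t := by
  have hvc := h.continuousOn_deriv hT hq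
  have hv : ∀ s ∈ T, c / 2 < v s := by
    by_contra! ⟨s, hs, hvs⟩
    -- Up to the first point `m` with `v m ≤ c / 2`, `y` is nonnegative, so `v` is nondecreasing.
    obtain ⟨m, ⟨hm, hvm⟩, hmin⟩ := (hT.isCompact.of_isClosed_subset
      (hvc.preimage_isClosed_of_isClosed hT.isClosed isClosed_Iic)
      inter_subset_left).exists_isLeast ⟨s, hs, mem_Iic.2 hvs⟩
    have hbefore : ∀ x ∈ T, x < m → c / 2 ≤ v x := fun x hx hxm =>
      (not_le.1 fun hle => (hmin ⟨hx, hle⟩).not_gt hxm).le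
    have hy : ∀ x ∈ T, x ≤ m → 0 ≤ y x := fun x hx hxm =>
      (mul_nonneg (half_pos hc).le (sub_nonneg.2 (hT.left_le hx))).trans
        (h.mul_sub_le hT hq hx fun r hr => hbefore r hr.1 (hr.2.2.trans_le hxm))
    have hmono := mul_sub_le_sub_of_le_deltaDeriv (c := 0) hT.isClosed hT.left_mem hm
      (hT.left_le hm) (hvc.mono inter_subset_left)
      (fun x hx => h.hasDeltaDerivAt_deriv hT hq hx.1) fun x hx => by
        rw [← neg_mul]
        exact mul_nonneg (neg_nonneg.2 (hneg x hx.1))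
          (hy _ (sigma_mem hT.isClosed hx.1) (sigma_le hm hx.2.2))
    rw [h.deriv_left hT] at hmono
    linarith [show v m ≤ c / 2 from hvm]
  exact (mul_pos (half_pos hc) (sub_pos.2 hat)).trans_le
    (h.mul_sub_le hT hq ht fun s hs => (hv s hs.1).le)

theorem hasDeltaDerivAt_wronskian (hT : IsCompactScale T a b) (hq : ContinuousOn q T)
    (h : IsShootingSolution T a c q lam y v) (h' : IsShootingSolution T a k q mu z w)
    (ht : t ∈ T) : HasDeltaDerivAt T (fun s => y s * w s - z s * v s)
      ((lam - mu) * (y (sigma T t) * z (sigma T t))) t := by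
  convert ((h.hasDeltaDerivAt hT hq ht).mul ht (h'.hasDeltaDerivAt_deriv hT hq ht)).sub
    ((h'.hasDeltaDerivAt hT hq ht).mul ht (h.hasDeltaDerivAt_deriv hT hq ht)) using 1
  ring

theorem exists_ne_zero (hT : IsCompactScale T a b) (hab : a < b) (hq : ContinuousOn q T)
    (h : IsShootingSolution T a c q lam y v) (hc : c ≠ 0) : ∃ t ∈ T, y t ≠ 0 := by
  by_contra! hy
  have ha := hT.left_mem
  refine hc (h.deriv_left hT ▸ (h.hasDeltaDerivAt hT hq ha).unique ha
    (hT.accPt_of_sigma_eq hab (hT.mem_kappa_of_lt ha hab)) ?_)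
  exact (hasDeltaDerivAt_const 0).congr hT.isClosed ha hy

theorem deriv_right_neg (hT : IsCompactScale T a b) (hab : a < b) (hq : ContinuousOn q T)
    (h : IsShootingSolution T a c q lam y v) (hc : c ≠ 0) (hy : ∀ t ∈ T, 0 ≤ y t)
    (h' : IsShootingSolution T a k q mu z w) (hz : ∀ t ∈ T, a < t → 0 < z t) (hmu : mu < lam)
    (hyb : y b = 0) : v b < 0 := by
  by_contra! hvb
  have hya := h.left_eq_zero hT
  have hza := h'.left_eq_zero hT
  have hz' : ∀ t ∈ T, 0 ≤ z t := fun t ht => by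
    rcases (hT.left_le ht).eq_or_lt with rfl | hat
    · exact hza.ge
    · exact (hz t ht hat).le
  have hW : IsAntiderivative T (fun t => (lam - mu) * (y (sigma T t) * z (sigma T t)))
      (fun t => y t * w t - z t * v t) := fun t ht =>
    h.hasDeltaDerivAt_wronskian hT hq h' (hT.kappa_subset ht)
  have hσ {t : ℝ} (ht : t ∈ kappa T) : sigma T t ∈ T := sigma_mem hT.isClosed (hT.kappa_subset ht)
  obtain ⟨t, ht, hyt⟩ := h.exists_ne_zero hT hab hq hc
  -- If `v b ≥ 0`, the nondecreasing Wronskian `y w - z v` is `0` at `a` and nonpositive at `b`, so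
  -- its derivative vanishes.
  refine hyt (hT.eqOn_zero_of_comp_sigma h.continuousOn hya (fun s hs => ?_) ht)
  have hzero := hT.eq_zero_of_isAntiderivative hab hW
    (fun t ht => mul_nonneg (sub_pos.2 hmu).le (mul_nonneg (hy _ (hσ ht)) (hz' _ (hσ ht))))
    (by simpa [hya, hza, hyb] using mul_nonneg (hz' b hT.right_mem) hvb) hs
  rcases (hT.left_le (hσ hs)).eq_or_lt with haσ | haσ
  · rw [← haσ, hya]
  · simpa [(sub_pos.2 hmu).ne', (hz _ (hσ hs) haσ).ne'] using hzero

theorem pos_of_nonneg (hT : IsCompactScale T a b) (hq : ContinuousOn q T)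
    (h : IsShootingSolution T a c q lam y v) (hc : c ≠ 0) (hy : ∀ t ∈ T, 0 ≤ y t)
    (h' : IsShootingSolution T a k q mu z w) (hz : ∀ t ∈ T, a < t → 0 < z t) (hmu : mu < lam)
    (ht : t ∈ T ∩ Ioo a b) : 0 < y t := by
  obtain ⟨ht, hat, htb⟩ := ht
  refine (hy t ht).lt_of_ne' fun hyt => ?_
  have hv : v t < 0 := deriv_right_neg (hT.inter_Iic ht) hat (hq.mono inter_subset_left)
    (h.inter_Iic hT ht) hc (fun s hs => hy s hs.1) (h'.inter_Iic hT ht)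
    (fun s hs => hz s hs.1) hmu hyt
  obtain ⟨s, ⟨hs, hts, -⟩, hle⟩ := ((h.hasDeltaDerivAt hT hq ht).const_mul
    (-1)).exists_mul_sub_le_sub hT.isClosed ht hT.right_mem htb (c := -v t / 2) (by linarith)
  rw [hyt] at hle
  nlinarith [hy s hs]

end IsShootingSolution

section Family

variable {y v : ℝ → ℝ → ℝ}

theorem eventually_forall_pos (hT : IsCompactScale T a b) (hq : ContinuousOn q T)
    (h : ∀ mu, IsShootingSolution T a 1 q mu (y mu) (v mu))
    (hy : ContinuousOn (Function.uncurry y) (univ ×ˢ T))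
    (hv : ContinuousOn (Function.uncurry v) (univ ×ˢ T)) (hpos : ∀ t ∈ T, a < t → 0 < y lam t) :
    ∀ᶠ mu in 𝓝 lam, ∀ t ∈ T, a < t → 0 < y mu t := by
  have hlt {f : ℝ → ℝ → ℝ} (hf : ContinuousOn (Function.uncurry f) (univ ×ˢ T)) {t l : ℝ}
      (ht : t ∈ T) (hl : l < f lam t) : ∀ᶠ p in 𝓝 (lam, t), p.2 ∈ T → l < f p.1 p.2 := by
    filter_upwards [eventually_nhdsWithin_iff.1 ((hf (lam, t) ⟨mem_univ _, ht⟩).tendsto.eventually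
      (lt_mem_nhds hl))] with p hp hpT using hp ⟨mem_univ _, hpT⟩
  suffices ∀ t ∈ T, ∀ᶠ p in 𝓝 (lam, t), p.2 ∈ T → a < p.2 → 0 < y p.1 p.2 from
    (hT.isCompact.eventually_forall_of_forall_eventually
      (P := fun mu t => t ∈ T → a < t → 0 < y mu t) this).mono fun mu hmu t ht => hmu t ht ht
  intro t ht
  rcases (hT.left_le ht).eq_or_lt with rfl | hat
  -- At `a`, where `y` vanishes, positivity is inherited from `y^Δ > 1 / 2` nearby.
  · have hv1 : 1 / 2 < v lam a := by rw [(h lam).deriv_left hT]; norm_num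
    have hnear := hlt hv ht hv1
    rw [nhds_prod_eq, eventually_prod_iff] at hnear
    obtain ⟨P, hP, Q, hQ, hPQ⟩ := hnear
    obtain ⟨l, u, hau, hQu⟩ := mem_nhds_iff_exists_Ioo_subset.1 hQ
    filter_upwards [hP.prod_inl_nhds a, (eventually_lt_nhds hau.2).prod_inr_nhds lam]
      with p hp hpu hpT hap
    refine (mul_pos one_half_pos (sub_pos.2 hap)).trans_le
      ((h p.1).mul_sub_le hT hq hpT fun s hs => (hPQ hp (hQu ?_) hs.1).le)
    exact ⟨hau.1.trans_le hs.2.1, hs.2.2.trans hpu⟩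
  · filter_upwards [hlt hy ht (hpos t ht hat)] with p hp hpT _ using hp hpT

theorem nonneg_of_mem_closure (hT : IsCompactScale T a b)
    (h : ∀ mu, IsShootingSolution T a 1 q mu (y mu) (v mu))
    (hy : ContinuousOn (Function.uncurry y) (univ ×ˢ T))
    (hlam : lam ∈ closure {mu | ∀ t ∈ T, a < t → 0 < y mu t}) (ht : t ∈ T) : 0 ≤ y lam t := by
  rcases (hT.left_le ht).eq_or_lt with rfl | hat
  · exact ((h _).left_eq_zero hT).ge
  have hcont : Continuous fun mu => y mu t :=
    hy.comp_continuous (Continuous.prodMk_left t) fun _ => ⟨mem_univ _, ht⟩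
  exact closure_minimal (fun mu hmu => (hmu t ht hat).le)
    (isClosed_le continuous_const hcont) hlam

end Family

theorem IsCompactScale.exists_isShootingSolution_isRayleighLowerBound (hT : IsCompactScale T a b)
    (hm : (T ∩ Ioo a b).Nonempty) (hq : ContinuousOn q T) :
    ∃ (lam : ℝ) (y v : ℝ → ℝ), IsShootingSolution T a 1 q lam y v ∧ y b = 0 ∧
      IsRayleighLowerBound T a b q lam := by
  obtain ⟨y, v, h, hy, hv⟩ := hT.exists_isShootingSolution hq
  have hab : a < b := hm.elim fun m hm => hm.2.1.trans hm.2.2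
  set S : Set ℝ := {lam | ∀ t ∈ T, a < t → 0 < y lam t}
  have hray : S ⊆ {lam | IsRayleighLowerBound T a b q lam} := fun lam hlam =>
    (h lam).isRayleighLowerBound hT hab hq hlam
  have hne : S.Nonempty := by
    obtain ⟨M, hM⟩ := hT.isCompact.bddAbove_image hq
    exact ⟨-M, fun t ht hat => (h (-M)).pos_of_nonpos hT hq one_pos
      (fun s hs => by linarith [hM (mem_image_of_mem q hs)]) ht hat⟩
  have hbdd : BddAbove S := hT.bddAbove_setOf_isRayleighLowerBound hm |>.mono hray
  have hclosure : sSup S ∈ closure S := csSup_mem_closure hne hbdd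
  have hnotMem : sSup S ∉ S := fun hmem => by
    obtain ⟨mu, hmu, hlt⟩ := (((eventually_forall_pos hT hq h hy hv hmem).filter_mono
      nhdsWithin_le_nhds).and (self_mem_nhdsWithin (s := Ioi (sSup S)))).exists
    exact (le_csSup hbdd hmu).not_gt hlt
  obtain ⟨mu, hmu, -⟩ := exists_lt_of_lt_csSup hne (sub_one_lt (sSup S))
  have hlt : mu < sSup S := (le_csSup hbdd hmu).lt_of_ne fun heq => hnotMem (heq ▸ hmu)
  have hnonneg : ∀ t ∈ T, 0 ≤ y (sSup S) t := fun t => nonneg_of_mem_closure hT h hy hclosure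
  refine ⟨sSup S, y _, v _, h _, ?_, closure_minimal hray isClosed_setOf_isRayleighLowerBound
    hclosure⟩
  by_contra hyb
  refine hnotMem fun t ht hat => ?_
  rcases (hT.le_right ht).eq_or_lt with rfl | htb
  · exact (hnonneg t ht).lt_of_ne' hyb
  · exact (h _).pos_of_nonneg hT hq one_ne_zero hnonneg (h mu) hmu hlt ⟨ht, hat, htb⟩

end Positivity

section SturmLiouville

variable {T : Set ℝ} {f g q y v : ℝ → ℝ} {a b c lam t : ℝ}

theorem IsCompactScale.rdContinuousOn_kappa_kappa (hT : IsCompactScale T a b)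
    (hf : RdContinuousOn (kappa T) (kappa T) f) (hgf : EqOn g f (kappa (kappa T))) :
    RdContinuousOn T (kappa (kappa T)) g := by
  have hκ := hT.kappa.kappa_subset
  refine fun t ht => ⟨fun hσ => ?_, fun hρ => ?_⟩
  · have hσκ : sigma (kappa T) t = t :=
      (hT.sigma_kappa (hT.kappa_subset (hκ ht)) (hσ.symm ▸ hκ ht)).trans hσ
    exact (((hf t (hκ ht)).1 hσκ).mono hκ).congr hgf (hgf ht)
  · obtain ⟨l, hl⟩ := (hf t (hκ ht)).2 ((hT.rho_kappa (hκ ht)).trans hρ)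
    exact ⟨l, (hl.mono_left (nhdsWithin_mono t (inter_subset_inter_left _ hκ))).congr'
      (eventually_nhdsWithin_of_forall fun s hs => (hgf hs.1).symm)⟩

theorem IsC2rd.hasDeltaDerivAt (h : IsC2rd T y) (ht : t ∈ kappa T) :
    HasDeltaDerivAt T y (deltaDeriv T y t) t :=
  (h.diff t ht).hasDeltaDerivAt

theorem IsC2rd.hasDeltaDerivAt_deltaDeriv (h : IsC2rd T y) (ht : t ∈ kappa (kappa T)) :
    HasDeltaDerivAt (kappa T) (deltaDeriv T y) (deltaDeriv2 T y t) t :=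
  (h.diff2 t ht).hasDeltaDerivAt

theorem IsC2rd.continuousOn (h : IsC2rd T y) (hT : IsCompactScale T a b) : ContinuousOn y T :=
  hT.continuousOn_of_hasDeltaDerivAt fun _ => h.hasDeltaDerivAt

theorem IsC2rd.continuousOn_deltaDeriv (h : IsC2rd T y) (hT : IsCompactScale T a b) :
    ContinuousOn (deltaDeriv T y) T :=
  hT.continuousOn_of_kappa fun t ht => by
    rw [ContinuousWithinAt, ← hT.nhdsWithin_kappa ht]
    exact hT.kappa.continuousOn_of_hasDeltaDerivAt (fun _ => h.hasDeltaDerivAt_deltaDeriv) t ht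

theorem IsShootingSolution.isSolution (hT : IsCompactScale T a b) (hm : (T ∩ Ioo a b).Nonempty)
    (hq : ContinuousOn q T) (h : IsShootingSolution T a c q lam y v) : IsSolution T q lam y := by
  obtain ⟨m, hmT, ham, hmb⟩ := hm
  have hκ : IsShootingSolution (kappa T) a c q lam y v :=
    hT.kappa_eq ▸ h.inter_Iic hT hT.rho_right_mem
  have hqκ := hq.mono hT.kappa_subset
  have hy {t : ℝ} (ht : t ∈ kappa T) : HasDeltaDerivAt T y (v t) t :=
    h.hasDeltaDerivAt hT hq (hT.kappa_subset ht)
  have hyv : EqOn (deltaDeriv T y) v (kappa T) := fun t ht =>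
    hT.deltaDeriv_eq (ham.trans hmb) ht (hy ht)
  have hv {t : ℝ} (ht : t ∈ kappa (kappa T)) : HasDeltaDerivAt (kappa T) (deltaDeriv T y)
      (-((q t + lam) * y (sigma (kappa T) t))) t :=
    have htκ := hT.kappa.kappa_subset ht
    (hκ.hasDeltaDerivAt_deriv hT.kappa hqκ htκ).congr hT.kappa.isClosed htκ hyv
  have hv2 : EqOn (deltaDeriv2 T y) (fun t => 0 - (q t + lam) * y (sigma (kappa T) t))
      (kappa (kappa T)) := fun t ht =>
    (hT.kappa.deltaDeriv_eq (ham.trans_le (le_rho hmT hmb)) ht (hv ht)).trans (zero_sub _).symm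
  refine ⟨⟨fun t ht => ⟨_, hy ht⟩, fun t ht => ⟨_, hv ht⟩, ?_⟩, fun t ht hσ => ?_⟩
  · exact hT.rdContinuousOn_kappa_kappa ((rdContinuousOn_of_continuousOn continuousOn_const).sub
      (hκ.rdContinuousOn hT.kappa hqκ)) hv2
  · rw [hv2 ht]
    beta_reduce
    rw [hT.sigma_kappa (hT.kappa_subset (hT.kappa.kappa_subset ht)) hσ]
    ring

theorem IsSolution.isAntiderivative_mul (hT : IsCompactScale T a b) (h : IsSolution T q lam y)
    (hyb : y b = 0) :
    IsAntiderivative T (fun t => deltaDeriv T y t ^ 2 - (q t + lam) * y (sigma T t) ^ 2)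
      (fun t => y t * deltaDeriv T y t) := by
  intro t ht
  have htT := hT.kappa_subset ht
  have hy := h.1.hasDeltaDerivAt ht
  by_cases hσ : sigma T t ∈ kappa T
  · have htκ := hT.mem_kappa_kappa ht hσ
    convert hy.mul htT ((hT.hasDeltaDerivAt_kappa_iff ht hσ).1
      (h.1.hasDeltaDerivAt_deltaDeriv htκ)) using 1
    linear_combination -y (sigma T t) * h.2 t htκ hσ
  -- The equation says nothing at such a `t`, but there `σ t = b` and `y b = 0`.
  · have hσb := hT.eq_right_of_notMem_kappa (sigma_mem hT.isClosed htT) hσ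
    have hlt : t < sigma T t := (le_sigma htT).lt_of_ne fun heq => hσ (heq ▸ ht)
    have hjump := hy.sub_eq htT
    refine (hasDeltaDerivAt_iff htT).2 ⟨(h.1.continuousOn hT t htT).mul
      (h.1.continuousOn_deltaDeriv hT t htT), ?_, fun heq => absurd heq hlt.ne'⟩
    have hyσ : y (sigma T t) = 0 := hσb ▸ hyb
    beta_reduce
    rw [hyσ] at hjump ⊢
    linear_combination deltaDeriv T y t * hjump

theorem IsSolution.deltaIntegral_eq (hT : IsCompactScale T a b) (hq : ContinuousOn q T)
    (h : IsSolution T q lam y) (hya : y a = 0) (hyb : y b = 0) :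
    deltaIntegral T a b (fun t => deltaDeriv T y t ^ 2 - q t * y (sigma T t) ^ 2)
      = lam * deltaIntegral T a b fun t => y (sigma T t) ^ 2 := by
  rw [hT.deltaIntegral_sq_sub_mul_sq hq
    (rdContinuousOn_of_continuousOn (h.1.continuousOn_deltaDeriv hT)) (h.1.continuousOn hT) lam,
    hT.deltaIntegral_eq (h.isAntiderivative_mul hT hyb), hya, hyb, zero_mul, zero_mul, sub_zero,
    zero_add]

end SturmLiouville

section Eigenvalue

variable {𝕋 : Set ℝ} {q y v z : ℝ → ℝ} {a b c lam : ℝ}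

theorem IsEigenfunction.nonempty_inter_Ioo (h : IsEigenfunction 𝕋 a b q lam y) :
    (𝕋 ∩ Ioo a b).Nonempty := by
  obtain ⟨-, hya, hyb, t, ⟨ht, hat, htb⟩, hyt⟩ := h
  exact ⟨t, ht, hat.lt_of_ne (ne_of_apply_ne y (hya ▸ hyt.symm)),
    htb.lt_of_ne (ne_of_apply_ne y (hyb ▸ hyt))⟩

theorem IsEigenfunction.J_eq (hT : IsCompactScale (interval 𝕋 a b) a b)
    (hq : ContinuousOn q (interval 𝕋 a b)) (h : IsEigenfunction 𝕋 a b q lam y) :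
    J 𝕋 a b q y = lam * I 𝕋 a b y :=
  h.1.deltaIntegral_eq hT hq h.2.1 h.2.2.1

theorem IsEigenfunction.I_pos (hT : IsCompactScale (interval 𝕋 a b) a b) (hab : a < b)
    (h : IsEigenfunction 𝕋 a b q lam y) : 0 < I 𝕋 a b y :=
  hT.deltaIntegral_sq_pos hab (h.1.1.continuousOn hT) h.2.1 h.2.2.2

theorem I_const_mul (hT : IsCompactScale (interval 𝕋 a b) a b)
    (hy : ContinuousOn y (interval 𝕋 a b)) (c : ℝ) :
    I 𝕋 a b (fun t => c * y t) = c ^ 2 * I 𝕋 a b y := by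
  have hrd {y : ℝ → ℝ} (hy : ContinuousOn y (interval 𝕋 a b)) :=
    (rdContinuousOn_comp_sigma hT.isClosed hy).pow 2
  rw [I, I, hT.deltaIntegral_eq_primitive (hrd (y := fun t => c * y t) (continuousOn_const.mul hy)),
    hT.deltaIntegral_eq_primitive (hrd hy), ← primitive_const_mul]
  simp only [mul_pow]

theorem IsRayleighLowerBound.mul_I_le_J (hT : IsCompactScale (interval 𝕋 a b) a b)
    (h : IsRayleighLowerBound (interval 𝕋 a b) a b q lam) (hz : IsC2rd (interval 𝕋 a b) z)
    (hza : z a = 0) (hzb : z b = 0) : lam * I 𝕋 a b z ≤ J 𝕋 a b q z :=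
  h z _ (fun _ => hz.hasDeltaDerivAt)
    (rdContinuousOn_of_continuousOn (hz.continuousOn_deltaDeriv hT)) hza hzb

theorem IsRayleighLowerBound.isLeast_eigenvalues (hT : IsCompactScale (interval 𝕋 a b) a b)
    (hab : a < b) (hq : ContinuousOn q (interval 𝕋 a b))
    (h : IsRayleighLowerBound (interval 𝕋 a b) a b q lam) (hy : IsEigenfunction 𝕋 a b q lam y) :
    IsLeast (eigenvalues 𝕋 a b q) lam := by
  refine ⟨⟨y, hy⟩, fun mu ⟨z, hz⟩ => le_of_mul_le_mul_right ?_ (hz.I_pos hT hab)⟩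
  exact (h.mul_I_le_J hT hz.1.1 hz.2.1 hz.2.2.1).trans_eq (hz.J_eq hT hq)

theorem IsShootingSolution.isEigenfunction (hT : IsCompactScale (interval 𝕋 a b) a b)
    (hm : (interval 𝕋 a b ∩ Ioo a b).Nonempty) (hq : ContinuousOn q (interval 𝕋 a b))
    (h : IsShootingSolution (interval 𝕋 a b) a c q lam y v) (hc : c ≠ 0) (hyb : y b = 0) :
    IsEigenfunction 𝕋 a b q lam y :=
  ⟨h.isSolution hT hm hq, h.left_eq_zero hT, hyb,
    h.exists_ne_zero hT (hm.elim fun _ hm => hm.2.1.trans hm.2.2) hq hc⟩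

theorem exists_isRayleighLowerBound_isEigenfunction (hT : IsCompactScale (interval 𝕋 a b) a b)
    (hm : (𝕋 ∩ Ioo a b).Nonempty) (hq : ContinuousOn q (interval 𝕋 a b)) :
    ∃ (lam : ℝ) (y : ℝ → ℝ), IsRayleighLowerBound (interval 𝕋 a b) a b q lam ∧
      IsEigenfunction 𝕋 a b q lam y ∧ I 𝕋 a b y = 1 := by
  have hm' : (interval 𝕋 a b ∩ Ioo a b).Nonempty :=
    hm.mono fun t ht => ⟨⟨ht.1, ht.2.1.le, ht.2.2.le⟩, ht.2⟩
  obtain ⟨lam, y, v, h, hyb, hray⟩ := hT.exists_isShootingSolution_isRayleighLowerBound hm' hq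
  have hI : 0 < I 𝕋 a b y := (h.isEigenfunction hT hm' hq one_ne_zero hyb).I_pos hT
    (hm.elim fun _ hm => hm.2.1.trans hm.2.2)
  have hk : (√(I 𝕋 a b y))⁻¹ * 1 ≠ 0 := by positivity
  refine ⟨lam, _, hray, (h.const_mul _).isEigenfunction hT hm' hq hk (by rw [hyb, mul_zero]), ?_⟩
  rw [I_const_mul hT h.continuousOn, inv_pow, Real.sq_sqrt hI.le, inv_mul_cancel₀ hI.ne']

end Eigenvalue

end TimeScale

theorem theorem2 (𝕋 : Set ℝ) (h𝕋 : IsClosed 𝕋) (a b : ℝ) (ha : a ∈ 𝕋) (hb : b ∈ 𝕋) (hab : a < b)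
    (q : ℝ → ℝ) (hq : ContinuousOn q (TimeScale.interval 𝕋 a b)) :
    -- the first eigenvalue and a normalized eigenfunction exist once `[a, b]` has a third point
    ((𝕋 ∩ Set.Ioo a b).Nonempty →
      ∃ (lam₁ : ℝ) (y₁ : ℝ → ℝ), IsLeast (TimeScale.eigenvalues 𝕋 a b q) lam₁ ∧
        TimeScale.IsEigenfunction 𝕋 a b q lam₁ y₁ ∧ TimeScale.I 𝕋 a b y₁ = 1) ∧
    ∀ (lam₁ : ℝ) (y₁ : ℝ → ℝ), IsLeast (TimeScale.eigenvalues 𝕋 a b q) lam₁ →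
      TimeScale.IsEigenfunction 𝕋 a b q lam₁ y₁ → TimeScale.I 𝕋 a b y₁ = 1 →
      y₁ ∈ TimeScale.admissible 𝕋 a b ∧
        IsMinOn (TimeScale.J 𝕋 a b q) (TimeScale.admissible 𝕋 a b) y₁ ∧
        TimeScale.J 𝕋 a b q y₁ = lam₁ := by
  have hT := TimeScale.isCompactScale_interval h𝕋 ha hb hab.le
  refine ⟨fun hm => ?_, fun lam₁ y₁ hleast hy hI => ?_⟩
  · obtain ⟨lam, y, hray, hy, hI⟩ := TimeScale.exists_isRayleighLowerBound_isEigenfunction hT hm hq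
    exact ⟨lam, y, hray.isLeast_eigenvalues hT hab hq hy, hy, hI⟩
  · have hJ : TimeScale.J 𝕋 a b q y₁ = lam₁ := by rw [hy.J_eq hT hq, hI, mul_one]
    obtain ⟨lam, y, hray, hy', -⟩ :=
      TimeScale.exists_isRayleighLowerBound_isEigenfunction hT hy.nonempty_inter_Ioo hq
    obtain rfl := (hray.isLeast_eigenvalues hT hab hq hy').unique hleast
    refine ⟨⟨hy.1.1, hy.2.1, hy.2.2.1, hI⟩, fun z ⟨hz, hza, hzb, hIz⟩ => ?_, hJ⟩
    calc TimeScale.J 𝕋 a b q y₁ = lam * TimeScale.I 𝕋 a b z := by rw [hJ, hIz, mul_one]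
      _ ≤ TimeScale.J 𝕋 a b q z := hray.mul_I_le_J hT hz hza hzb
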